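/- **Setting.** Let $\mathcal X$ be a measurable space, $f:\mathcal X\to[0,1]$ measurable, and $P,Q$ (source and target) probability measures on $\mathcal X\times\{0,1\}$, the laws of a pair $(X,Y)$. Put $p_k=P[Y=k]$, $q_k=Q[Y=k]$, $w^*_k=q_k/p_k$, $p_{\min}=\min_k p_k$, $q_{\min}=\min_k q_k$, $w^*_{\max}=\max_k w^*_k$, $w^*_{\min}=\min_k w^*_k$. Assume *label shift*: $P[X\in S\mid Y=k]=Q[X\in S\mid Y=k]$ for all measurable $S$ and $k\in\{0,1\}$, and $p_1,q_1\in(0,1)$. For $h:[0,1]\to[0,1]$ let $R_P(h)=\mathbb E_P\big[(h(f(X))-\mathbb E_P[Y\mid f(X)])^2\big]$, and similarly $R_Q(h)$. **Estimators.** Given data $\mathcal D_P=(x_i,y_i)_{i\le n_P}$, $\mathcal D_Q=(x'_i,y'_i)_{i\le n_Q}$ and $B\ge1$, let $z_{(1)}\le\dots\le z_{(n_P)}$ be the ordered scores $f(x_i)$ (with $z_{(0)}:=0$), $u_0=0$, $u_B=1$, $u_b=z_{(\lfloor n_Pb/B\rfloor)}$ for $0<b<B$. The uniform-mass bins are $I_1=[u_0,u_1]$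 and $I_b=(u_{b-1},u_b]$ for $2\le b\le B$, and $\hat h_P$ equals on each $I_b$ the mean of the labels $y_i$ with $f(x_i)\in I_b$ ($0$ if there are none). With $\hat p_k,\hat q_k$ the empirical class frequencies in $\mathcal D_P,\mathcal D_Q$, let $\hat w_k=\hat q_k/\hat p_k$, $\rho_k=\hat w_k/w^*_k$ and $\hat g(z)=\dfrac{\hat w_1z}{\hat w_1z+\hat w_0(1-z)}$ (a quotient with zero denominator being read as $0$). **Theorem.** (1) For all data sets with $n_Q\ge1$ and $\hat p_0,\hat p_1>0$, and all $B\ge 1$, $$R_Q(\hat g\circ\hat h_P)\le 2\Big\{\Big(\frac{\rho_0-\rho_1}{\rho_0+\rho_1}\Big)^2+\frac{(w^*_{\max})^3}{(w^*_{\min})^2}\,R_P(\hat h_P)\Big\}.$$ (2) Suppose moreover that under $P$ the law of $f(X)$ has no atoms (for instance, has a positive density), and that some version $h^*:[0,1]\to[0,1]$ of $z\mapsto P[Y=1\mid f(X)=z]$ is non-decreasing and $K$-smooth with respect to $F(z)=P[f(X)\le z]$: $|h^*(z_2)-h^*(z_1)|\le K(F(z_2)-F(z_1))$ for $0\le z_1\le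 z_2\le1$, where $K\ge 0$. There is a universal constant $c>0$ such that for all $\delta\in(0,1)$, $B\ge1$, and $\mathcal D_P$, $\mathcal D_Q$ i.i.d. samples from $P$ and $Q$ of sizes $$n_P\ge\max\Big\{c,\frac{27}{p_{\min}}\Big\}B\log\frac{4B}{\delta},\qquad n_Q\ge\frac{27}{q_{\min}}\log\frac{16}{\delta},$$ with probability at least $1-\delta$, $$R_Q(\hat g\circ\hat h_P)\le 2\frac{(w^*_{\max})^3}{(w^*_{\min})^2}\Big\{\varepsilon^2+\frac{8K^2}{B^2}\Big\}+54\max\Big\{\frac1{p_{\min}n_P},\frac1{q_{\min}n_Q}\Big\}\log\frac{16}{\delta},$$ where $\varepsilon=\sqrt{\dfrac{1}{2(\lfloor n_P/B\rfloor-1)}\log\dfrac{8B}{\delta}}+\dfrac1{\lfloor n_P/B\rfloor}$. (3) Consequently $O(1/\eta)$ target labels suffice for risk $\eta$: there is a universal constant $C>0$ such that, under the assumptions of (2), for all $\delta,\eta\in(0,1)$ and $0<a_1\le a_2$ there is $N$ (depending on $P,Q,f,K,\delta,\eta,a_1,a_2$) such that for all i.i.d. samples with $n_P\ge N$ and $n_Q\ge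 \dfrac{C\log(16/\delta)}{q_{\min}}\cdot\dfrac1\eta$, and all $B$ with $a_1n_P^{1/3}\le B\le a_2n_P^{1/3}$, one has $R_Q(\hat g\circ\hat h_P)\le\eta$ with probability at least $1-\delta$. -/

import Mathlib

open MeasureTheory ProbabilityTheory Set

noncomputable section

namespace LabelShiftRecalibration

/-- The numerical value `0` or `1` of a binary label. -/
def labelValue (y : Fin 2) : ℝ := ((y : ℕ) : ℝ)

section Population

variable {𝒳 : Type*} [MeasurableSpace 𝒳]

/-- The class marginal `P[Y = k]` of a law `P` of a pair `(X, Y)`. -/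
def classProb (P : Measure (𝒳 × Fin 2)) (k : Fin 2) : ℝ :=
  P.real {ω | ω.2 = k}

/-- Label shift: equal class-conditional laws of `X`, and both classes present in both domains. -/
structure LabelShift (P Q : Measure (𝒳 × Fin 2)) : Prop where
  cond_eq : ∀ (k : Fin 2) (S : Set 𝒳), MeasurableSet S →
    ProbabilityTheory.cond P {ω | ω.2 = k} {ω | ω.1 ∈ S} =
      ProbabilityTheory.cond Q {ω | ω.2 = k} {ω | ω.1 ∈ S}
  source_mem : classProb P 1 ∈ Ioo (0 : ℝ) 1
  target_mem : classProb Q 1 ∈ Ioo (0 : ℝ) 1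

/-- `min_k P[Y = k]`. -/
def minClassProb (P : Measure (𝒳 × Fin 2)) : ℝ := min (classProb P 0) (classProb P 1)

/-- The true weights `w*_k = Q[Y = k] / P[Y = k]`. -/
def trueWeight (P Q : Measure (𝒳 × Fin 2)) (k : Fin 2) : ℝ := classProb Q k / classProb P k

/-- `w*_max`. -/
def maxWeight (P Q : Measure (𝒳 × Fin 2)) : ℝ := max (trueWeight P Q 0) (trueWeight P Q 1)

/-- `w*_min`. -/
def minWeight (P Q : Measure (𝒳 × Fin 2)) : ℝ := min (trueWeight P Q 0) (trueWeight P Q 1)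

/-- The conditional expectation `E_P[Y | f(X)]`, as a random variable. -/
def condLabel (P : Measure (𝒳 × Fin 2)) (f : 𝒳 → ℝ) : 𝒳 × Fin 2 → ℝ :=
  condExp (MeasurableSpace.comap (fun ω : 𝒳 × Fin 2 => f ω.1) inferInstance) P
    (fun ω => labelValue ω.2)

/-- The recalibration risk `R_P(h; f) = E_P[(h(f(X)) - E_P[Y | f(X)])²]`. -/
def risk (P : Measure (𝒳 × Fin 2)) (f : 𝒳 → ℝ) (h : ℝ → ℝ) : ℝ :=
  ∫ ω, (h (f ω.1) - condLabel P f ω) ^ 2 ∂P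

/-- `h : [0,1] → [0,1]` is (a version of) the optimal recalibration function
`z ↦ P[Y = 1 | f(X) = z]`. -/
structure IsOptimalRecalibration (P : Measure (𝒳 × Fin 2)) (f : 𝒳 → ℝ) (h : ℝ → ℝ) : Prop where
  measurable : Measurable h
  mapsTo : MapsTo h (Icc 0 1) (Icc 0 1)
  ae_eq : (fun ω : 𝒳 × Fin 2 => h (f ω.1)) =ᵐ[P] condLabel P f

/-- The cumulative distribution function `z ↦ P[f(X) ≤ z]` of the score. -/
def scoreCdf (P : Measure (𝒳 × Fin 2)) (f : 𝒳 → ℝ) (z : ℝ) : ℝ :=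
  P.real {ω | f ω.1 ≤ z}

/-- `φ` is `K`-smooth with respect to `ψ` on `[0,1]`. -/
def SmoothWrt (K : ℝ) (φ ψ : ℝ → ℝ) : Prop :=
  ∀ z₁ ∈ Icc (0 : ℝ) 1, ∀ z₂ ∈ Icc (0 : ℝ) 1, z₁ ≤ z₂ →
    |φ z₂ - φ z₁| ≤ K * (ψ z₂ - ψ z₁)

/-- The regularity assumptions on the score and on the optimal recalibration function `h`
under the source: the law of `f(X)` has no atoms, `h` is a version of `P[Y = 1 | f(X) = ·]`,
`h` is non-decreasing, and `h` is `K`-smooth with respect to the distribution function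
of `f(X)`. -/
structure RegularScore (P : Measure (𝒳 × Fin 2)) (f : 𝒳 → ℝ) (h : ℝ → ℝ) (K : ℝ) : Prop where
  no_atoms : ∀ z : ℝ, P {ω | f ω.1 = z} = 0
  optimal : IsOptimalRecalibration P f h
  monotone : MonotoneOn h (Icc 0 1)
  smooth : SmoothWrt K h (scoreCdf P f)

end Population

section Sample

/-- The `i`-th smallest entry `z_(i)` of `z`, for `1 ≤ i ≤ n` (and `0` for other `i`). -/
def orderStat {n : ℕ} (z : Fin n → ℝ) (i : ℕ) : ℝ :=
  if h : 1 ≤ i ∧ i ≤ n then z (Tuple.sort z ⟨i - 1, by omega⟩) else 0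

/-- The break points `u_0 = 0`, `u_b = z_(⌊n b / B⌋)` for `0 < b < B`, `u_B = 1`. -/
def umbEdge {n : ℕ} (z : Fin n → ℝ) (B b : ℕ) : ℝ :=
  if b = 0 then 0 else if B ≤ b then 1 else orderStat z (n * b / B)

/-- The bins of the uniform-mass binning scheme of size `B` induced by `z`: the bin with index
`0` is `[u_0, u_1]`, the bin with index `b ≥ 1` is `(u_b, u_{b+1}]`. -/
def umbBin {n : ℕ} (z : Fin n → ℝ) (B b : ℕ) : Set ℝ :=
  if b = 0 then Icc (umbEdge z B 0) (umbEdge z B 1)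
  else Ioc (umbEdge z B b) (umbEdge z B (b + 1))

/-- The empirical mean of the labels `y i` over the indices `i` with `z i ∈ I`. -/
def binMean {n : ℕ} (z y : Fin n → ℝ) (I : Set ℝ) : ℝ :=
  (∑ i, I.indicator (fun _ => y i) (z i)) / (∑ i, I.indicator (fun _ => (1 : ℝ)) (z i))

variable {𝒳 : Type*}

/-- The recalibration function obtained from the data `D` by uniform-mass binning with `B` bins
of the scores `f(x_i)`: on each bin it equals the empirical mean of the labels in that bin. -/
def umbRecalibration (f : 𝒳 → ℝ) {n : ℕ} (D : Fin n → 𝒳 × Fin 2) (B : ℕ) (t : ℝ) : ℝ :=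
  ∑ b ∈ Finset.range B, (umbBin (fun i => f (D i).1) B b).indicator
    (fun _ => binMean (fun i => f (D i).1) (fun i => labelValue (D i).2)
      (umbBin (fun i => f (D i).1) B b)) t

/-- The empirical class frequency `(1/n) #{i : y_i = k}`. -/
def empClassProb {n : ℕ} (D : Fin n → 𝒳 × Fin 2) (k : Fin 2) : ℝ :=
  ((Finset.univ.filter fun i => (D i).2 = k).card : ℝ) / n

/-- The estimated weights `ŵ_k`. -/
def empWeight {m n : ℕ} (DP : Fin m → 𝒳 × Fin 2) (DQ : Fin n → 𝒳 × Fin 2) (k : Fin 2) : ℝ :=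
  empClassProb DQ k / empClassProb DP k

/-- The shift correction function `z ↦ w_1 z / (w_1 z + w_0 (1 - z))`. -/
def shiftCorrection (w : Fin 2 → ℝ) (z : ℝ) : ℝ :=
  w 1 * z / (w 1 * z + w 0 * (1 - z))

/-- The two-stage estimator `ĝ ∘ ĥ_P`. -/
def compositeEstimator (f : 𝒳 → ℝ) {m n : ℕ} (DP : Fin m → 𝒳 × Fin 2) (DQ : Fin n → 𝒳 × Fin 2)
    (B : ℕ) : ℝ → ℝ :=
  shiftCorrection (empWeight DP DQ) ∘ umbRecalibration f DP B

/-- The ratios `ρ_k = ŵ_k / w*_k`. -/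
def weightRatio [MeasurableSpace 𝒳] (P Q : Measure (𝒳 × Fin 2)) {m n : ℕ}
    (DP : Fin m → 𝒳 × Fin 2) (DQ : Fin n → 𝒳 × Fin 2) (k : Fin 2) : ℝ :=
  empWeight DP DQ k / trueWeight P Q k

/-- `D 0, …, D (n-1)` is an i.i.d. sample from `P`, defined on the probability space `(Ω, μ)`. -/
structure IsIIDSample {Ω E : Type*} [MeasurableSpace Ω] [MeasurableSpace E] (μ : Measure Ω)
    (P : Measure E) {n : ℕ} (D : Fin n → Ω → E) : Prop where
  measurable : ∀ i, Measurable (D i)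
  law : ∀ i, μ.map (D i) = P
  indep : iIndepFun D μ

end Sample

end LabelShiftRecalibration

end

/-!
Recalibration under label shift: uniform-mass binning on the source sample, followed by a shift
correction with estimated class weights.

*Reduction to the source.* Under label shift the target law has the density `w*_Y` with respect to
the source law (`target_eq_withDensity`), so `E_Q[Y | f(X)]` is the shift correction `g*` of
`E_P[Y | f(X)]` (`condLabel_target_ae_eq`). The map `g*` is Lipschitz with constant
`w*_max / w*_min`, the estimated correction differs from `g*` by at most `|ρ₀ - ρ₁| / (ρ₀ + ρ₁)`
uniformly, and integrals under `Q` are at most `w*_max` times those under `P`. This gives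
the deterministic bound `risk_compositeEstimator_le`.

*Risk under the source.* On a bin, the squared error splits into the calibration error of the bin
mean and the variance of the optimal recalibration function `h*`. For the first, fix the
draws, at most two, that serve as end points of the bin, together with their ranks; the draws strictly between them
are independent with the conditional law of the bin, so Hoeffding's inequality applies
(`pi_rankEvent_inter_deviationEvent_le`). Since without ties the ranks determine the end points,
summing over all choices of end points costs nothing (`pi_exists_deviation_le`), and the draw at the
right end point accounts for the term `1 / ⌊nP / B⌋`. For the variance, a Chernoff bound for a grid
of `B` quantiles shows that no bin has mass above `4 / B` (`umbBin_mass_le`), and a monotone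
`K`-smooth function then varies by at most `4 K / B` on a bin. Both are combined in
`pi_risk_umbRecalibration_gt_le`.

*Weights.* Chernoff bounds give the class frequencies up to relative errors `a` and `b`, whence
`|ρ₀ - ρ₁| / (ρ₀ + ρ₁) ≤ a + b` (`abs_ratio_le`). A union bound yields
`finite_sample_risk_bound`; all terms in it except the one for the target sample vanish as
`nP → ∞` with `B` of order `nP ^ (1/3)` (`exists_source_sample_size`), which gives the target sample
complexity.
-/

namespace LabelShiftRecalibration

/-! ### Concentration for independent draws -/

section Concentration

variable {E : Type*} [MeasurableSpace E]

/-- The mean of `g` over the event `A`, that is, `E[g | A]` (and `0` if `A` is a null set). -/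
noncomputable def condMean (P : Measure E) (A : Set E) (g : E → ℝ) : ℝ :=
  (∫ x in A, g x ∂P) / P.real A

lemma integrable_of_mem_Icc {P : Measure E} [IsFiniteMeasure P] {g : E → ℝ} {a b : ℝ}
    (hg : Measurable g) (h : ∀ x, g x ∈ Icc a b) : Integrable g P :=
  Integrable.of_mem_Icc a b hg.aemeasurable (ae_of_all _ h)

/-- Hoeffding's lemma for the restriction of a law to an event. -/
lemma setIntegral_exp_le (P : Measure E) [IsProbabilityMeasure P] {A : Set E}
    {g : E → ℝ} (hg : Measurable g) (hg01 : ∀ x, g x ∈ Icc (0 : ℝ) 1) (s : ℝ) :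
    ∫ x in A, Real.exp (s * (g x - condMean P A g)) ∂P ≤ P.real A * Real.exp (s ^ 2 / 8) := by
  by_cases hA0 : P A = 0
  · have : P.restrict A = 0 := Measure.restrict_eq_zero.2 hA0
    simp [this, measureReal_def, hA0]
  have hpos : 0 < P.real A := by
    rw [measureReal_def]; exact ENNReal.toReal_pos hA0 (measure_ne_top _ _)
  have : IsProbabilityMeasure (ProbabilityTheory.cond P A) := cond_isProbabilityMeasure hA0
  have key := (hasSubgaussianMGF_of_mem_Icc (μ := ProbabilityTheory.cond P A) (X := g)
    hg.aemeasurable (ae_of_all _ hg01)).mgf_le s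
  have hcond : ∀ φ : E → ℝ, ∫ x, φ x ∂(ProbabilityTheory.cond P A) =
      (∫ x in A, φ x ∂P) / P.real A := by
    intro φ
    rw [ProbabilityTheory.cond, integral_smul_measure, ENNReal.toReal_inv, smul_eq_mul,
      measureReal_def]
    field_simp
  rw [mgf, hcond, hcond, div_le_iff₀ hpos] at key
  refine key.trans (le_of_eq ?_)
  rw [mul_comm]
  congr 2
  simp
  ring

lemma measureReal_pi_forall_mem {κ : Type*} [Fintype κ] (P : Measure E) [IsProbabilityMeasure P]
    (S : κ → Set E) :
    (Measure.pi fun _ : κ => P).real {x | ∀ k, x k ∈ S k} = ∏ k, P.real (S k) := by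
  have : {x : κ → E | ∀ k, x k ∈ S k} = Set.univ.pi S := by ext; simp
  rw [this, measureReal_def, Measure.pi_pi, ENNReal.toReal_prod]
  rfl

/-- A Hoeffding bound for independent draws, on the event that each draw lies in a prescribed set:
the draws with index in `J` are required to lie in `A`, and are centred at the mean over `A`. -/
lemma measureReal_pi_forall_mem_and_sum_ge_le {κ : Type*} [Fintype κ] [DecidableEq κ]
    (P : Measure E) [IsProbabilityMeasure P] {S : κ → Set E} (hS : ∀ k, MeasurableSet (S k))
    {A : Set E} {J : Finset κ} (hJ : ∀ k ∈ J, S k = A)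
    {g : E → ℝ} (hg : Measurable g) (hg01 : ∀ x, g x ∈ Icc (0 : ℝ) 1) {t : ℝ} (ht : 0 ≤ t) :
    (Measure.pi fun _ : κ => P).real
        {x | (∀ k, x k ∈ S k) ∧ t * J.card ≤ ∑ k ∈ J, (g (x k) - condMean P A g)} ≤
      Real.exp (-2 * J.card * t ^ 2) * (Measure.pi fun _ : κ => P).real {x | ∀ k, x k ∈ S k} := by
  set μ := condMean P A g with hμ
  -- the parameter `4 t` minimises the exponent `s ^ 2 / 8 - s * t` of the Chernoff bound
  let φ : κ → E → ℝ := fun k => (S k).indicator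
    (fun x => if k ∈ J then Real.exp (4 * t * (g x - μ)) else 1)
  have hφ0 : ∀ k x, 0 ≤ φ k x := fun k x => by
    apply Set.indicator_nonneg; intro x _; split_ifs <;> positivity
  have hφm : ∀ k, Measurable (φ k) := fun k => by
    refine Measurable.indicator ?_ (hS k)
    split_ifs <;> fun_prop
  have hφb : ∀ k x, φ k x ≤ max 1 (Real.exp (4 * t * (1 - μ))) := fun k x => by
    refine Set.indicator_apply_le' (fun _ => ?_) (fun _ => by positivity)
    split_ifs
    · refine le_max_of_le_right (Real.exp_le_exp.2 ?_)
      have := (hg01 x).2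
      gcongr
    · exact le_max_left _ _
  have hφi : ∀ k, Integrable (φ k) P := fun k =>
    integrable_of_mem_Icc (hφm k) fun x => ⟨hφ0 k x, hφb k x⟩
  have hint : ∀ k, ∫ x, φ k x ∂P ≤
      P.real (S k) * (if k ∈ J then Real.exp ((4 * t) ^ 2 / 8) else 1) := fun k => by
    simp only [φ]
    rw [integral_indicator (hS k)]
    split_ifs with hk
    · have := setIntegral_exp_le P (A := A) hg hg01 (4 * t)
      rwa [hJ k hk]
    · simp
  have hset : MeasurableSet {x : κ → E | (∀ k, x k ∈ S k) ∧
      t * J.card ≤ ∑ k ∈ J, (g (x k) - μ)} := by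
    have h2 : MeasurableSet {x : κ → E | t * J.card ≤ ∑ k ∈ J, (g (x k) - μ)} :=
      measurableSet_le (by fun_prop) (by fun_prop)
    refine MeasurableSet.inter ?_ h2
    have : {x : κ → E | ∀ k, x k ∈ S k} = Set.univ.pi S := by ext; simp
    change MeasurableSet {x : κ → E | ∀ k, x k ∈ S k}
    rw [this]
    exact MeasurableSet.univ_pi hS
  have hprodint : Integrable (fun x : κ → E => ∏ k, φ k (x k)) (Measure.pi fun _ : κ => P) :=
    Integrable.fintype_prod_dep hφi
  calc (Measure.pi fun _ : κ => P).real
        {x | (∀ k, x k ∈ S k) ∧ t * J.card ≤ ∑ k ∈ J, (g (x k) - μ)}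
      = ∫ x, indicator {x : κ → E | (∀ k, x k ∈ S k) ∧
          t * J.card ≤ ∑ k ∈ J, (g (x k) - μ)} 1 x ∂(Measure.pi fun _ : κ => P) := by
        rw [integral_indicator_one hset]
    _ ≤ ∫ x, Real.exp (-(4 * t * (t * J.card))) * ∏ k, φ k (x k)
          ∂(Measure.pi fun _ : κ => P) := by
        refine integral_mono ((integrable_const (1 : ℝ)).indicator hset)
          (hprodint.const_mul _) fun x => ?_
        refine Set.indicator_apply_le' (fun hx => ?_) (fun _ => ?_)
        · have h1 : ∏ k, φ k (x k) = Real.exp (4 * t * ∑ k ∈ J, (g (x k) - μ)) := by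
            rw [Finset.mul_sum, Real.exp_sum, ← Finset.prod_subset (Finset.subset_univ J)]
            · refine Finset.prod_congr rfl fun k hk => ?_
              simp [φ, hx.1 k, hk]
            · intro k _ hk
              simp [φ, hx.1 k, hk]
          rw [h1, ← Real.exp_add]
          refine Real.one_le_exp ?_
          have := mul_le_mul_of_nonneg_left hx.2 (by positivity : (0 : ℝ) ≤ 4 * t)
          linarith
        · exact mul_nonneg (Real.exp_pos _).le (Finset.prod_nonneg fun k _ => hφ0 k _)
    _ = Real.exp (-(4 * t * (t * J.card))) * ∏ k, ∫ x, φ k x ∂P := by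
        rw [integral_const_mul, integral_fintype_prod_eq_prod]
    _ ≤ Real.exp (-(4 * t * (t * J.card))) *
          ∏ k, P.real (S k) * (if k ∈ J then Real.exp ((4 * t) ^ 2 / 8) else 1) := by
        gcongr with k _
        · intro k _; exact integral_nonneg (hφ0 k)
        · exact hint k
    _ = _ := by
        rw [Finset.prod_mul_distrib, measureReal_pi_forall_mem, Finset.prod_ite_mem,
          Finset.univ_inter, Finset.prod_const, ← Real.exp_nat_mul, mul_left_comm, mul_comm,
          ← Real.exp_add]
        congr 2
        ring

/-- Hoeffding's inequality for the draws that fall into the cell `T = a₀` of a finite partition,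
on an event `W` that depends only on the cells of the draws: given the cells, the draws in the
cell `a₀` are independent with mean `condMean P (T ⁻¹' {a₀}) g`. -/
lemma measureReal_pi_inter_sum_ge_le {κ α : Type*} [Fintype κ] [DecidableEq κ]
    [Fintype α] [DecidableEq α]
    (P : Measure E) [IsProbabilityMeasure P] {T : E → α} (hT : ∀ a, MeasurableSet (T ⁻¹' {a}))
    (a₀ : α) {W : Set (κ → E)}
    (hW : ∀ x x' : κ → E, (∀ k, T (x k) = T (x' k)) → x ∈ W → x' ∈ W)
    {m : ℕ} (hm : ∀ x ∈ W, m ≤ (Finset.univ.filter fun k => T (x k) = a₀).card)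
    {g : E → ℝ} (hg : Measurable g) (hg01 : ∀ x, g x ∈ Icc (0 : ℝ) 1) {t : ℝ} (ht : 0 ≤ t) :
    (Measure.pi fun _ : κ => P).real
        {x | x ∈ W ∧ t * (Finset.univ.filter fun k => T (x k) = a₀).card ≤
          ∑ k with T (x k) = a₀, (g (x k) - condMean P (T ⁻¹' {a₀}) g)} ≤
      Real.exp (-2 * m * t ^ 2) * (Measure.pi fun _ : κ => P).real W := by
  set π := Measure.pi fun _ : κ => P
  set S := {x | x ∈ W ∧ t * (Finset.univ.filter fun k => T (x k) = a₀).card ≤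
          ∑ k with T (x k) = a₀, (g (x k) - condMean P (T ⁻¹' {a₀}) g)} with hSdef
  let fib : (κ → α) → Set (κ → E) := fun σ => {x | ∀ k, x k ∈ T ⁻¹' {σ k}}
  have hfibm : ∀ σ, MeasurableSet (fib σ) := fun σ => by
    have : fib σ = Set.univ.pi fun k => T ⁻¹' {σ k} := by ext; simp [fib]
    rw [this]
    exact MeasurableSet.univ_pi fun k => hT _
  have hfibW : ∀ σ, (∃ x ∈ W, x ∈ fib σ) → fib σ ⊆ W := by
    rintro σ ⟨x, hxW, hx⟩ y hy
    refine hW x y (fun k => ?_) hxW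
    have h1 := hx k
    have h2 := hy k
    simp only [mem_preimage, mem_singleton_iff] at h1 h2
    rw [h1, h2]
  have hWm : ∀ σ, MeasurableSet (W ∩ fib σ) := fun σ => by
    by_cases h : ∃ x ∈ W, x ∈ fib σ
    · rw [inter_eq_right.2 (hfibW σ h)]; exact hfibm σ
    · have : W ∩ fib σ = ∅ := by
        ext x; simp only [mem_inter_iff, mem_empty_iff_false, iff_false]
        exact fun hx => h ⟨x, hx.1, hx.2⟩
      rw [this]; exact MeasurableSet.empty
  have hcover : ∀ U : Set (κ → E), U = ⋃ σ ∈ (Finset.univ : Finset (κ → α)), U ∩ fib σ := by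
    intro U; ext x
    simp only [Finset.mem_univ, iUnion_true, mem_iUnion, mem_inter_iff, exists_and_left, fib]
    exact ⟨fun h => ⟨h, fun k => T (x k), fun k => rfl⟩, fun h => h.1⟩
  have hsum : π.real W = ∑ σ, π.real (W ∩ fib σ) := by
    conv_lhs => rw [hcover W]
    refine measureReal_biUnion_finset (fun σ _ τ _ hne => ?_) (fun σ _ => hWm σ)
    refine Set.disjoint_left.2 fun x hx hy => hne ?_
    funext k
    have h1 := hx.2 k
    have h2 := hy.2 k
    simp only [mem_preimage, mem_singleton_iff] at h1 h2
    rw [← h1, ← h2]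
  rw [hsum, Finset.mul_sum]
  conv_lhs => rw [hcover S]
  refine (measureReal_biUnion_finset_le _ _).trans (Finset.sum_le_sum fun σ _ => ?_)
  by_cases h : ∃ x ∈ W, x ∈ fib σ
  · obtain ⟨x₀, hx₀W, hx₀⟩ := id h
    rw [inter_eq_right.2 (hfibW σ h)]
    have hfilt : ∀ x ∈ fib σ, (Finset.univ.filter fun k => T (x k) = a₀) =
        Finset.univ.filter fun k => σ k = a₀ := by
      intro x hx
      refine Finset.filter_congr fun k _ => ?_
      rw [show T (x k) = σ k from hx k]
    have hmain := measureReal_pi_forall_mem_and_sum_ge_le P (S := fun k => T ⁻¹' {σ k})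
      (fun k => hT _) (A := T ⁻¹' {a₀}) (J := Finset.univ.filter fun k => σ k = a₀)
      (fun k hk => by rw [(Finset.mem_filter.1 hk).2]) hg hg01 ht
    refine (measureReal_mono ?_).trans (hmain.trans ?_)
    · rintro x ⟨hx, hxf⟩
      refine ⟨hxf, ?_⟩
      rw [← hfilt x hxf]
      exact hx.2
    · refine mul_le_mul_of_nonneg_right (Real.exp_le_exp.2 ?_) measureReal_nonneg
      have := hm x₀ hx₀W
      rw [hfilt x₀ hx₀] at this
      have h' : (m : ℝ) ≤ ((Finset.univ.filter fun k => σ k = a₀).card : ℝ) := by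
        exact_mod_cast this
      nlinarith [sq_nonneg t]
  · have : S ∩ fib σ = ∅ := by
      ext x; simp only [mem_inter_iff, mem_empty_iff_false, iff_false]
      exact fun hx => h ⟨x, hx.1.1, hx.2⟩
    rw [this]; simp only [measureReal_empty]; positivity

lemma condMean_one_sub {P : Measure E} [IsProbabilityMeasure P] {A : Set E} (hA : P A ≠ 0)
    {g : E → ℝ} (hg : Measurable g) (hg01 : ∀ x, g x ∈ Icc (0 : ℝ) 1) :
    condMean P A (fun x => 1 - g x) = 1 - condMean P A g := by
  have hpos : P.real A ≠ 0 := by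
    rw [measureReal_def]; exact (ENNReal.toReal_pos hA (measure_ne_top _ _)).ne'
  unfold condMean
  rw [integral_sub (integrable_const _) (integrable_of_mem_Icc hg hg01)]
  simp
  field_simp

/-- The two-sided form of `measureReal_pi_inter_sum_ge_le`. -/
lemma measureReal_pi_inter_abs_sum_ge_le {κ α : Type*} [Fintype κ] [DecidableEq κ]
    [Fintype α] [DecidableEq α]
    (P : Measure E) [IsProbabilityMeasure P] {T : E → α} (hT : ∀ a, MeasurableSet (T ⁻¹' {a}))
    (a₀ : α) {W : Set (κ → E)}
    (hW : ∀ x x' : κ → E, (∀ k, T (x k) = T (x' k)) → x ∈ W → x' ∈ W)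
    {m : ℕ} (hm0 : 0 < m) (hm : ∀ x ∈ W, m ≤ (Finset.univ.filter fun k => T (x k) = a₀).card)
    {g : E → ℝ} (hg : Measurable g) (hg01 : ∀ x, g x ∈ Icc (0 : ℝ) 1) {t : ℝ} (ht : 0 ≤ t) :
    (Measure.pi fun _ : κ => P).real
        {x | x ∈ W ∧ t * (Finset.univ.filter fun k => T (x k) = a₀).card ≤
          |∑ k with T (x k) = a₀, (g (x k) - condMean P (T ⁻¹' {a₀}) g)|} ≤
      2 * Real.exp (-2 * m * t ^ 2) * (Measure.pi fun _ : κ => P).real W := by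
  by_cases hA : P (T ⁻¹' {a₀}) = 0
  · -- the cell `a₀` is a null set, while `W` forces at least one draw to fall into it
    have hnull : (Measure.pi fun _ : κ => P) {x : κ → E | ∃ k, T (x k) = a₀} = 0 := by
      have : {x : κ → E | ∃ k, T (x k) = a₀} = ⋃ k, Function.eval k ⁻¹' (T ⁻¹' {a₀}) := by
        ext; simp
      rw [this]
      refine measure_iUnion_null fun k => ?_
      exact Measure.pi_eval_preimage_null (fun _ : κ => P) hA
    have h0 : (Measure.pi fun _ : κ => P).real
        {x | x ∈ W ∧ t * (Finset.univ.filter fun k => T (x k) = a₀).card ≤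
          |∑ k with T (x k) = a₀, (g (x k) - condMean P (T ⁻¹' {a₀}) g)|} = 0 := by
      rw [measureReal_def, measure_mono_null _ hnull, ENNReal.toReal_zero]
      rintro x ⟨hx, -⟩
      obtain ⟨k, hk⟩ := Finset.card_pos.1 (hm0.trans_le (hm x hx))
      exact ⟨k, (Finset.mem_filter.1 hk).2⟩
    rw [h0]
    positivity
  have h1 := measureReal_pi_inter_sum_ge_le P hT a₀ hW hm hg hg01 ht
  have h2 := measureReal_pi_inter_sum_ge_le P hT a₀ hW hm (g := fun x => 1 - g x)
    (by fun_prop) (fun x => ⟨by linarith [(hg01 x).2], by linarith [(hg01 x).1]⟩) ht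
  rw [condMean_one_sub hA hg hg01] at h2
  refine ((measureReal_mono ?_).trans (measureReal_union_le _ _)).trans
    ((add_le_add h1 h2).trans (le_of_eq (by ring)))
  rintro x ⟨hx, hxt⟩
  rcases le_abs.1 hxt with h | h
  · exact Or.inl ⟨hx, h⟩
  · refine Or.inr ⟨hx, h.trans (le_of_eq ?_)⟩
    rw [← Finset.sum_neg_distrib]
    exact Finset.sum_congr rfl fun k _ => by ring

/-- Fubini's theorem for an inequality between the probabilities of two events: it may be checked
on the sections obtained by fixing the coordinates `i` with `p i`. -/
lemma pi_le_mul_of_sections {ι : Type*} [Fintype ι] (P : Measure E) [IsProbabilityMeasure P]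
    (p : ι → Prop) [DecidablePred p] {S S' : Set (ι → E)} (hS : MeasurableSet S)
    (hS' : MeasurableSet S') (C : ENNReal)
    (h : ∀ e : {i // p i} → E,
      (Measure.pi fun _ : {i // ¬ p i} => P)
        {x | (MeasurableEquiv.piEquivPiSubtypeProd (fun _ => E) p).symm (e, x) ∈ S} ≤
      C * (Measure.pi fun _ : {i // ¬ p i} => P)
        {x | (MeasurableEquiv.piEquivPiSubtypeProd (fun _ => E) p).symm (e, x) ∈ S'}) :
    (Measure.pi fun _ : ι => P) S ≤ C * (Measure.pi fun _ : ι => P) S' := by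
  have hmp := (measurePreserving_piEquivPiSubtypeProd (fun _ : ι => P) p).symm
  have key : ∀ U : Set (ι → E), MeasurableSet U → (Measure.pi fun _ : ι => P) U =
      ∫⁻ e, (Measure.pi fun _ : {i // ¬ p i} => P)
        {x | (MeasurableEquiv.piEquivPiSubtypeProd (fun _ => E) p).symm (e, x) ∈ U}
        ∂(Measure.pi fun _ : {i // p i} => P) := by
    intro U hU
    rw [← hmp.measure_preimage hU.nullMeasurableSet, Measure.prod_apply (hmp.measurable hU)]
    rfl
  have hmeas : Measurable fun e => (Measure.pi fun _ : {i // ¬ p i} => P)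
        {x | (MeasurableEquiv.piEquivPiSubtypeProd (fun _ => E) p).symm (e, x) ∈ S'} :=
    measurable_measure_prodMk_left (hmp.measurable hS')
  rw [key S hS, key S' hS', ← lintegral_const_mul _ hmeas]
  exact lintegral_mono h

/-- A multiplicative Chernoff bound for the number of draws that fall into `A`. -/
lemma measureReal_pi_abs_card_sub_ge_le {κ : Type*} [Fintype κ] [DecidableEq κ]
    (P : Measure E) [IsProbabilityMeasure P] {A : Set E} (hA : MeasurableSet A)
    [DecidablePred (· ∈ A)] {η : ℝ} (hη0 : 0 ≤ η) (hη : η ≤ 2) :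
    (Measure.pi fun _ : κ => P).real
        {x | η * (Fintype.card κ * P.real A) ≤
          |((Finset.univ.filter fun k => x k ∈ A).card : ℝ) - Fintype.card κ * P.real A|} ≤
      2 * Real.exp (-(η ^ 2 * (Fintype.card κ * P.real A) / 4)) := by
  set n : ℝ := (Fintype.card κ : ℝ)
  set q := P.real A
  let N : (κ → E) → ℝ := fun x => ((Finset.univ.filter fun k => x k ∈ A).card : ℝ)
  have hN : ∀ x, N x = ∑ k, A.indicator 1 (x k) := fun x => by
    simp [N, Set.indicator_apply]
  have hpw : ∀ s x, Real.exp (s * N x) = ∏ k, Real.exp (s * A.indicator 1 (x k)) := fun s x => by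
    rw [hN, Finset.mul_sum, Real.exp_sum]
  have hind : Measurable (A.indicator (1 : E → ℝ)) := measurable_one.indicator hA
  have hexp_int : ∀ s, Integrable (fun x => Real.exp (s * A.indicator 1 x)) P := fun s => by
    refine integrable_of_mem_Icc (a := 0) (b := Real.exp |s|) (by fun_prop) fun x =>
      ⟨(Real.exp_pos _).le, Real.exp_le_exp.2 ?_⟩
    by_cases hx : x ∈ A <;> simp [hx, le_abs_self]
  have hone : ∀ s, |s| ≤ 1 → ∫ x, Real.exp (s * A.indicator 1 x) ∂P ≤
      Real.exp (q * (s + s ^ 2)) := fun s hs => by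
    have h1 : (fun x => Real.exp (s * A.indicator 1 x)) =
        fun x => 1 + (Real.exp s - 1) * A.indicator 1 x := by
      funext x
      by_cases hx : x ∈ A <;> simp [hx]
    have hi : Integrable (A.indicator (1 : E → ℝ)) P := (integrable_const (1 : ℝ)).indicator hA
    rw [h1, integral_add (integrable_const _) (hi.const_mul _), integral_const_mul,
      integral_indicator_one hA]
    have h2 := (abs_le.1 (Real.abs_exp_sub_one_sub_id_le hs)).2
    have h3 := Real.add_one_le_exp (q * (s + s ^ 2))
    have hq : 0 ≤ q := measureReal_nonneg
    have h4 : (Real.exp s - 1) * q ≤ q * (s + s ^ 2) := by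
      rw [mul_comm]; exact mul_le_mul_of_nonneg_left (by linarith) hq
    simp only [integral_const, probReal_univ, smul_eq_mul]
    linarith
  have hside : ∀ s, |s| ≤ 1 → ∀ r, (Measure.pi fun _ : κ => P).real {x | r ≤ s * (N x - n * q)} ≤
      Real.exp (-r + n * q * s ^ 2) := fun s hs r => by
    have hi : Integrable (fun x => Real.exp (1 * (s * (N x - n * q))))
        (Measure.pi fun _ : κ => P) := by
      have h : (fun x => Real.exp (1 * (s * (N x - n * q)))) = fun x =>
          (∏ k, Real.exp (s * A.indicator 1 (x k))) * Real.exp (-(s * (n * q))) := by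
        funext x
        rw [← hpw, ← Real.exp_add]; congr 1; ring
      rw [h]
      exact (Integrable.fintype_prod_dep fun k => hexp_int s).mul_const _
    refine (measure_ge_le_exp_mul_mgf r zero_le_one hi).trans ?_
    have h : mgf (fun x => s * (N x - n * q)) (Measure.pi fun _ : κ => P) 1 =
        Real.exp (-(s * (n * q))) * (∫ x, Real.exp (s * A.indicator 1 x) ∂P) ^ Fintype.card κ := by
      rw [mgf, ← integral_fintype_prod_eq_pow (ι := κ) (fun x => Real.exp (s * A.indicator 1 x)),
        ← integral_const_mul]
      congr 1
      funext x
      rw [← hpw, ← Real.exp_add]; ring_nf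
    rw [h]
    calc Real.exp (-1 * r) * (Real.exp (-(s * (n * q))) *
          (∫ x, Real.exp (s * A.indicator 1 x) ∂P) ^ Fintype.card κ)
        ≤ Real.exp (-1 * r) * (Real.exp (-(s * (n * q))) *
          (Real.exp (q * (s + s ^ 2))) ^ Fintype.card κ) := by
          gcongr
          exact hone s hs
      _ = Real.exp (-r + n * q * s ^ 2) := by
          rw [← Real.exp_nat_mul, ← Real.exp_add, ← Real.exp_add]
          congr 1
          simp only [n]; ring
  -- the parameters `± η / 2` minimise `s ^ 2 - |s| * η`, and `|s| ≤ 1` is what `η ≤ 2` is for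
  have hs1 : |η / 2| ≤ 1 := by rw [abs_of_nonneg (by positivity)]; linarith
  have hs2 : |-(η / 2)| ≤ 1 := by rwa [abs_neg]
  have h1 := hside _ hs1 (η ^ 2 * (n * q) / 2)
  have h2 := hside _ hs2 (η ^ 2 * (n * q) / 2)
  refine ((measureReal_mono ?_).trans (measureReal_union_le _ _)).trans
    ((add_le_add h1 h2).trans (le_of_eq ?_))
  · intro x hx
    rcases le_abs.1 (show η * (n * q) ≤ |N x - n * q| from hx) with h | h
    · refine Or.inl ?_
      have := mul_le_mul_of_nonneg_left h (by positivity : 0 ≤ η / 2)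
      simp only [mem_ofPred_eq]
      linarith
    · refine Or.inr ?_
      have := mul_le_mul_of_nonneg_left h (by positivity : 0 ≤ η / 2)
      simp only [mem_ofPred_eq]
      linarith
  · rw [two_mul]; congr 2 <;> ring

end Concentration

/-! ### Random intervals with end points among the draws -/

section RandomInterval

variable {E : Type*} [MeasurableSpace E] {n : ℕ}

/-- The number of entries of `v` that are at most `a`. -/
noncomputable def cntLe (v : Fin n → ℝ) (a : ℝ) : ℕ := (Finset.univ.filter fun k => v k ≤ a).card

/-- The number of entries of `v` that are less than `a`. -/
noncomputable def cntLt (v : Fin n → ℝ) (a : ℝ) : ℕ := (Finset.univ.filter fun k => v k < a).card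

/-- A left end point of a random interval: the score of the draw `i` for `some i`, and `-1`,
which lies to the left of all scores, for `none`. -/
noncomputable def leftEnd (v : Fin n → ℝ) (o : Option (Fin n)) : ℝ := o.elim (-1) v

/-- A right end point of a random interval: the score of the draw `i` for `some i`, and `2`,
which lies to the right of all scores, for `none`. -/
noncomputable def rightEnd (v : Fin n → ℝ) (o : Option (Fin n)) : ℝ := o.elim 2 v

/-- The event that the end points selected by `o` and `o'` have the ranks `r₁` and `r₂`: exactly
`r₁` draws are at most the left end, and exactly `r₂` draws are less than the right end. -/
def rankEvent (z : E → ℝ) (r₁ r₂ : ℕ) (o o' : Option (Fin n)) : Set (Fin n → E) :=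
  {x | cntLe (z ∘ x) (leftEnd (z ∘ x) o) = r₁ ∧ cntLt (z ∘ x) (rightEnd (z ∘ x) o') = r₂}

/-- The event that the total deviation of `g` from its conditional mean, over the draws strictly
between the end points selected by `o` and `o'`, is at least `t` per draw. -/
def deviationEvent (P : Measure E) (z g : E → ℝ) (t : ℝ) (o o' : Option (Fin n)) :
    Set (Fin n → E) :=
  {x | t * (Finset.univ.filter fun k =>
        z (x k) ∈ Ioo (leftEnd (z ∘ x) o) (rightEnd (z ∘ x) o')).card ≤
      |∑ k with z (x k) ∈ Ioo (leftEnd (z ∘ x) o) (rightEnd (z ∘ x) o'),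
        (g (x k) - condMean P (z ⁻¹' Ioo (leftEnd (z ∘ x) o) (rightEnd (z ∘ x) o')) g)|}

lemma measurable_leftEnd {z : E → ℝ} (hz : Measurable z) (o : Option (Fin n)) :
    Measurable fun x : Fin n → E => leftEnd (z ∘ x) o := by
  cases o <;> simp only [leftEnd, Option.elim, Function.comp] <;> fun_prop

lemma measurable_rightEnd {z : E → ℝ} (hz : Measurable z) (o : Option (Fin n)) :
    Measurable fun x : Fin n → E => rightEnd (z ∘ x) o := by
  cases o <;> simp only [rightEnd, Option.elim, Function.comp] <;> fun_prop

/-- A sum over a random set of indices, as a sum of indicators, is measurable. -/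
lemma measurable_sum_filter {ι Ω : Type*} [Fintype ι] [MeasurableSpace Ω] {p : Ω → ι → Prop}
    [∀ x, DecidablePred (p x)] (hp : ∀ k, MeasurableSet {x | p x k}) {φ : ι → Ω → ℝ}
    (hφ : ∀ k, Measurable (φ k)) : Measurable fun x => ∑ k with p x k, φ k x := by
  simp only [Finset.sum_filter]
  exact Finset.measurable_fun_sum _ fun k _ => Measurable.ite (hp k) (hφ k) measurable_const

lemma measurable_card_filter {ι Ω : Type*} [Fintype ι] [MeasurableSpace Ω] {p : Ω → ι → Prop}
    [∀ x, DecidablePred (p x)] (hp : ∀ k, MeasurableSet {x | p x k}) :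
    Measurable fun x => (Finset.univ.filter fun k => p x k).card := by
  simp only [Finset.card_filter]
  exact Finset.measurable_fun_sum _ fun k _ =>
    Measurable.ite (hp k) measurable_const measurable_const

lemma measurableSet_mem_Ioo {Ω : Type*} [MeasurableSpace Ω] {u a b : Ω → ℝ} (hu : Measurable u)
    (ha : Measurable a) (hb : Measurable b) : MeasurableSet {x | u x ∈ Ioo (a x) (b x)} := by
  have h : {x | u x ∈ Ioo (a x) (b x)} = {x | a x < u x} ∩ {x | u x < b x} := by ext; simp
  rw [h]
  exact (measurableSet_lt ha hu).inter (measurableSet_lt hu hb)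

lemma measurableSet_rankEvent {z : E → ℝ} (hz : Measurable z) (r₁ r₂ : ℕ)
    (o o' : Option (Fin n)) : MeasurableSet (rankEvent z r₁ r₂ o o') := by
  have h1 : Measurable fun x : Fin n → E => cntLe (z ∘ x) (leftEnd (z ∘ x) o) :=
    measurable_card_filter fun k => measurableSet_le (by simp only [Function.comp]; fun_prop)
      (measurable_leftEnd hz o)
  have h2 : Measurable fun x : Fin n → E => cntLt (z ∘ x) (rightEnd (z ∘ x) o') :=
    measurable_card_filter fun k => measurableSet_lt (by simp only [Function.comp]; fun_prop)
      (measurable_rightEnd hz o')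
  exact (h1 (measurableSet_singleton r₁)).inter (h2 (measurableSet_singleton r₂))

lemma measurable_condMean_Ioo (P : Measure E) [IsProbabilityMeasure P] {z : E → ℝ}
    (hz : Measurable z) {g : E → ℝ} (hg : Measurable g) :
    Measurable fun q : ℝ × ℝ => condMean P (z ⁻¹' Ioo q.1 q.2) g := by
  have hS : MeasurableSet {y : (ℝ × ℝ) × E | z y.2 ∈ Ioo y.1.1 y.1.2} :=
    measurableSet_mem_Ioo (by fun_prop) (by fun_prop) (by fun_prop)
  refine Measurable.div ?_ ?_
  · have h : (fun q : ℝ × ℝ => ∫ x in z ⁻¹' Ioo q.1 q.2, g x ∂P) = fun q : ℝ × ℝ =>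
        ∫ x, ({y : (ℝ × ℝ) × E | z y.2 ∈ Ioo y.1.1 y.1.2}.indicator fun y => g y.2) (q, x) ∂P := by
      funext q
      rw [← integral_indicator (hz measurableSet_Ioo)]
      rfl
    rw [h]
    exact (StronglyMeasurable.integral_prod_right'
      ((hg.comp measurable_snd).indicator hS).stronglyMeasurable).measurable
  · exact (measurable_measure_prodMk_left hS).ennreal_toReal

lemma measurableSet_deviationEvent (P : Measure E) [IsProbabilityMeasure P] {z : E → ℝ}
    (hz : Measurable z) {g : E → ℝ} (hg : Measurable g) (t : ℝ) (o o' : Option (Fin n)) :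
    MeasurableSet (deviationEvent P z g t o o') := by
  have hl := measurable_leftEnd (n := n) hz o
  have hr := measurable_rightEnd (n := n) hz o'
  have hI : ∀ k, MeasurableSet {x : Fin n → E |
      z (x k) ∈ Ioo (leftEnd (z ∘ x) o) (rightEnd (z ∘ x) o')} := fun k =>
    measurableSet_mem_Ioo (by fun_prop) hl hr
  have hc : Measurable fun x : Fin n → E =>
      condMean P (z ⁻¹' Ioo (leftEnd (z ∘ x) o) (rightEnd (z ∘ x) o')) g :=
    (measurable_condMean_Ioo P hz hg).comp (hl.prodMk hr)
  have h1 : Measurable fun x : Fin n → E => ((Finset.univ.filter fun k =>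
      z (x k) ∈ Ioo (leftEnd (z ∘ x) o) (rightEnd (z ∘ x) o')).card : ℝ) :=
    measurable_from_top.comp (measurable_card_filter hI)
  have h2 : Measurable fun x : Fin n → E =>
      ∑ k with z (x k) ∈ Ioo (leftEnd (z ∘ x) o) (rightEnd (z ∘ x) o'),
        (g (x k) - condMean P (z ⁻¹' Ioo (leftEnd (z ∘ x) o) (rightEnd (z ∘ x) o')) g) :=
    measurable_sum_filter hI fun k => (by fun_prop : Measurable fun x : Fin n → E => g (x k)).sub hc
  have h3 : Measurable fun x : Fin n → E =>
      |∑ k with z (x k) ∈ Ioo (leftEnd (z ∘ x) o) (rightEnd (z ∘ x) o'),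
        (g (x k) - condMean P (z ⁻¹' Ioo (leftEnd (z ∘ x) o) (rightEnd (z ∘ x) o')) g)| := by
    simpa only [Real.norm_eq_abs] using h2.norm
  exact measurableSet_le (h1.const_mul t) h3

/-- Given the draws selected as end points, the draws between them are independent with the
conditional law of the interval: Hoeffding's inequality on the event that the end points have
prescribed ranks. -/
lemma pi_rankEvent_inter_deviationEvent_le (P : Measure E) [IsProbabilityMeasure P] {z : E → ℝ}
    (hz : Measurable z) {g : E → ℝ} (hg : Measurable g) (hg01 : ∀ x, g x ∈ Icc (0 : ℝ) 1)
    {t : ℝ} (ht : 0 ≤ t) {r₁ r₂ : ℕ} (hr : r₁ < r₂) (o o' : Option (Fin n)) :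
    (Measure.pi fun _ : Fin n => P) (rankEvent z r₁ r₂ o o' ∩ deviationEvent P z g t o o') ≤
      ENNReal.ofReal (2 * Real.exp (-2 * (r₂ - r₁ : ℕ) * t ^ 2)) *
        (Measure.pi fun _ : Fin n => P) (rankEvent z r₁ r₂ o o') := by
  classical
  have hRm := measurableSet_rankEvent (n := n) hz r₁ r₂ o o'
  let p : Fin n → Prop := fun k => some k = o ∨ some k = o'
  refine pi_le_mul_of_sections P p
    (hRm.inter (measurableSet_deviationEvent P hz hg t o o')) hRm _ fun e => ?_
  set c : ({k // ¬ p k} → E) → Fin n → E := fun x =>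
    (MeasurableEquiv.piEquivPiSubtypeProd (fun _ => E) p).symm (e, x) with hc
  have hcp : ∀ x k (h : p k), c x k = e ⟨k, h⟩ := fun x k h => by
    simp [hc, MeasurableEquiv.piEquivPiSubtypeProd, h]
  have hcn : ∀ x k (h : ¬ p k), c x k = x ⟨k, h⟩ := fun x k h => by
    simp [hc, MeasurableEquiv.piEquivPiSubtypeProd, h]
  obtain ⟨a, ha⟩ : ∃ a, ∀ x, leftEnd (z ∘ c x) o = a := by
    rcases ho : o with _ | i
    · exact ⟨-1, fun x => rfl⟩
    · exact ⟨z (e ⟨i, Or.inl ho.symm⟩), fun x => congrArg z (hcp x i (Or.inl ho.symm))⟩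
  obtain ⟨b, hb⟩ : ∃ b, ∀ x, rightEnd (z ∘ c x) o' = b := by
    rcases ho : o' with _ | i
    · exact ⟨2, fun x => rfl⟩
    · exact ⟨z (e ⟨i, Or.inr ho.symm⟩), fun x => congrArg z (hcp x i (Or.inr ho.symm))⟩
  have hpe : ∀ x k, p k → z (c x k) ∉ Ioo a b := by
    rintro x k hk ⟨h1, h2⟩
    rcases hk with hk | hk
    · rw [← ha x, ← hk] at h1; exact lt_irrefl _ h1
    · rw [← hb x, ← hk] at h2; exact lt_irrefl _ h2
  let T : E → Bool × Bool := fun y => (decide (z y ≤ a), decide (z y < b))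
  have hT1 : Measurable T :=
    (measurable_to_bool (by
        convert measurableSet_le hz (measurable_const (a := a)) using 1; ext; simp)).prodMk
      (measurable_to_bool (by
        convert measurableSet_lt hz (measurable_const (a := b)) using 1; ext; simp))
  have hTin : ∀ y, T y = (false, true) ↔ z y ∈ Ioo a b := fun y => by simp [T]
  have hTpre : T ⁻¹' {(false, true)} = z ⁻¹' Ioo a b := by
    ext y; exact hTin y
  -- the draws at the end points do not belong to the open interval between them
  have hsum : ∀ (φ : E → ℝ) x, ∑ k with z (c x k) ∈ Ioo a b, φ (c x k) =
      ∑ k with T (x k) = (false, true), φ (x k) := by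
    intro φ x
    simp only [Finset.sum_filter]
    rw [← Fintype.sum_subtype_add_sum_subtype p]
    rw [Finset.sum_eq_zero fun k _ => if_neg (hpe x k.1 k.2), zero_add]
    refine Finset.sum_congr rfl fun k _ => ?_
    rw [hcn x k.1 k.2]
    simp only [hTin]
  have hcard : ∀ x, (Finset.univ.filter fun k => z (c x k) ∈ Ioo a b).card =
      (Finset.univ.filter fun k => T (x k) = (false, true)).card := by
    intro x
    have := hsum (fun _ => 1) x
    simp only [Finset.sum_const, nsmul_eq_mul, mul_one] at this
    exact_mod_cast this
  have key := measureReal_pi_inter_abs_sum_ge_le (κ := {k // ¬ p k}) P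
    (fun a => hT1 (measurableSet_singleton a)) (false, true)
    (W := {x | c x ∈ rankEvent z r₁ r₂ o o'}) (m := r₂ - r₁) ?_ (by omega) ?_ hg hg01 ht
  · change (Measure.pi fun _ : {k // ¬ p k} => P)
        {x | c x ∈ rankEvent z r₁ r₂ o o' ∩ deviationEvent P z g t o o'} ≤
      _ * (Measure.pi fun _ : {k // ¬ p k} => P) {x | c x ∈ rankEvent z r₁ r₂ o o'}
    rw [← ENNReal.ofReal_toReal (measure_ne_top _ {x | c x ∈ rankEvent z r₁ r₂ o o'}),
      ← ENNReal.ofReal_mul (by positivity), ← ENNReal.ofReal_toReal (measure_ne_top _ _)]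
    refine ENNReal.ofReal_le_ofReal (le_trans ?_ key)
    refine measureReal_mono ?_
    rintro x ⟨hx1, hx2⟩
    refine ⟨hx1, ?_⟩
    simp only [deviationEvent, mem_ofPred_eq] at hx2
    rw [ha, hb, hcard, hsum fun y => g y - condMean P (z ⁻¹' Ioo a b) g] at hx2
    rw [hTpre]
    exact hx2
  · rintro x x' hxx ⟨h1, h2⟩
    have hle : ∀ k, z (c x k) ≤ a ↔ z (c x' k) ≤ a := fun k => by
      by_cases hk : p k
      · rw [hcp _ _ hk, hcp _ _ hk]
      · rw [hcn _ _ hk, hcn _ _ hk]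
        have := congrArg Prod.fst (hxx ⟨k, hk⟩)
        simpa [T] using this
    have hlt : ∀ k, z (c x k) < b ↔ z (c x' k) < b := fun k => by
      by_cases hk : p k
      · rw [hcp _ _ hk, hcp _ _ hk]
      · rw [hcn _ _ hk, hcn _ _ hk]
        have := congrArg Prod.snd (hxx ⟨k, hk⟩)
        simpa [T] using this
    rw [ha] at h1
    rw [hb] at h2
    refine ⟨?_, ?_⟩
    · rw [ha, ← h1, cntLe, cntLe]
      exact congrArg Finset.card (Finset.filter_congr fun k _ => (hle k).symm)
    · rw [hb, ← h2, cntLt, cntLt]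
      exact congrArg Finset.card (Finset.filter_congr fun k _ => (hlt k).symm)
  · rintro x ⟨h1, h2⟩
    rw [ha] at h1
    rw [hb] at h2
    rw [← hcard, ← h1, ← h2, cntLe, cntLt, tsub_le_iff_left]
    refine (Finset.card_le_card ?_).trans (Finset.card_union_le _ _)
    intro k hk
    simp only [Finset.mem_filter, Finset.mem_univ, true_and, Finset.mem_union,
      Function.comp] at hk ⊢
    rcases le_or_gt (z (c x k)) a with h | h
    · exact Or.inl h
    · exact Or.inr ⟨h, hk⟩

/-- If the score has no atoms, then there are almost surely no ties among the scores. -/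
lemma ae_injective_score (P : Measure E) [IsProbabilityMeasure P] {z : E → ℝ} (hz : Measurable z)
    (hna : ∀ c, P {x | z x = c} = 0) :
    ∀ᵐ x ∂(Measure.pi fun _ : Fin n => P), Function.Injective (z ∘ x) := by
  have h : ∀ i j : Fin n, i ≠ j → ∀ᵐ x ∂(Measure.pi fun _ : Fin n => P), z (x i) ≠ z (x j) := by
    intro i j hij
    rw [ae_iff]
    have := pi_le_mul_of_sections P (fun k => k = i) (S := {x : Fin n → E | z (x i) = z (x j)})
      (S' := univ) (measurableSet_eq_fun (by fun_prop) (by fun_prop)) MeasurableSet.univ 0 ?_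
    · simpa using this
    intro e
    rw [zero_mul, nonpos_iff_eq_zero]
    have hj : ¬ j = i := fun h => hij h.symm
    have hset : {x : {k // ¬ k = i} → E |
        (MeasurableEquiv.piEquivPiSubtypeProd (fun _ => E) (fun k => k = i)).symm (e, x) ∈
          {x : Fin n → E | z (x i) = z (x j)}} =
        Function.eval ⟨j, hj⟩ ⁻¹' {y | z y = z (e ⟨i, rfl⟩)} := by
      ext x
      simp [MeasurableEquiv.piEquivPiSubtypeProd, hj, eq_comm]
    rw [hset]
    exact Measure.pi_eval_preimage_null (fun _ : {k // ¬ k = i} => P) (hna _)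
  have h' : ∀ᵐ x ∂(Measure.pi fun _ : Fin n => P), ∀ i j : Fin n, i ≠ j → z (x i) ≠ z (x j) := by
    rw [ae_all_iff]; intro i
    rw [ae_all_iff]; intro j
    by_cases hij : i = j
    · simp [hij]
    · filter_upwards [h i j hij] with x hx _ using hx
  filter_upwards [h'] with x hx i j hij
  by_contra hne
  exact hx i j hne hij

lemma cntLe_lt_cntLe {v : Fin n → ℝ} {a : ℝ} {i : Fin n} (h : a < v i) :
    cntLe v a < cntLe v (v i) := by
  refine Finset.card_lt_card ⟨fun k hk => ?_, fun hsub => ?_⟩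
  · simp only [Finset.mem_filter, Finset.mem_univ, true_and] at hk ⊢
    linarith
  · have := hsub (show i ∈ _ by simp)
    simp only [Finset.mem_filter, Finset.mem_univ, true_and] at this
    linarith

lemma cntLt_lt_cntLt {v : Fin n → ℝ} {a : ℝ} {i : Fin n} (h : v i < a) :
    cntLt v (v i) < cntLt v a := by
  refine Finset.card_lt_card ⟨fun k hk => ?_, fun hsub => ?_⟩
  · simp only [Finset.mem_filter, Finset.mem_univ, true_and] at hk ⊢
    linarith
  · have := hsub (show i ∈ _ by simpa using h)
    simp only [Finset.mem_filter, Finset.mem_univ, true_and] at this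
    linarith

/-- Without ties, a left end point is determined by its rank. -/
lemma leftEnd_unique {v : Fin n → ℝ} (hv : Function.Injective v) (hv0 : ∀ i, v i ∈ Icc (0 : ℝ) 1)
    {o₁ o₂ : Option (Fin n)} (h : cntLe v (leftEnd v o₁) = cntLe v (leftEnd v o₂)) :
    o₁ = o₂ := by
  have haux : ∀ o i, cntLe v (leftEnd v o) = cntLe v (v i) → o = some i := by
    intro o i hoi
    rcases o with _ | j
    · have := cntLe_lt_cntLe (v := v) (a := -1) (i := i) (by linarith [(hv0 i).1])
      exact absurd hoi this.ne
    · rcases lt_trichotomy (v j) (v i) with hlt | heq | hgt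
      · exact absurd hoi (cntLe_lt_cntLe hlt).ne
      · rw [hv heq]
      · exact absurd hoi (cntLe_lt_cntLe hgt).ne'
  rcases o₂ with _ | i
  · rcases o₁ with _ | i
    · rfl
    · exact (haux none i h.symm).symm
  · exact haux o₁ i h

/-- Without ties, a right end point is determined by its rank. -/
lemma rightEnd_unique {v : Fin n → ℝ} (hv : Function.Injective v) (hv0 : ∀ i, v i ∈ Icc (0 : ℝ) 1)
    {o₁ o₂ : Option (Fin n)} (h : cntLt v (rightEnd v o₁) = cntLt v (rightEnd v o₂)) :
    o₁ = o₂ := by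
  have haux : ∀ o i, cntLt v (rightEnd v o) = cntLt v (v i) → o = some i := by
    intro o i hoi
    rcases o with _ | j
    · have := cntLt_lt_cntLt (v := v) (a := 2) (i := i) (by linarith [(hv0 i).2])
      exact absurd hoi this.ne'
    · rcases lt_trichotomy (v j) (v i) with hlt | heq | hgt
      · exact absurd hoi (cntLt_lt_cntLt hlt).ne
      · rw [hv heq]
      · exact absurd hoi (cntLt_lt_cntLt hgt).ne'
  rcases o₂ with _ | i
  · rcases o₁ with _ | i
    · rfl
    · exact (haux none i h.symm).symm
  · exact haux o₁ i h

/-- The union of the deviation events over all pairs of end points with ranks `r₁` and `r₂` obeys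
the same Hoeffding bound as each of them, without a union bound, because a pair of end points is
almost surely determined by its ranks. -/
lemma pi_exists_deviation_le (P : Measure E) [IsProbabilityMeasure P] {z : E → ℝ}
    (hz : Measurable z) (hz01 : ∀ x, z x ∈ Icc (0 : ℝ) 1) (hna : ∀ c, P {x | z x = c} = 0)
    {g : E → ℝ} (hg : Measurable g) (hg01 : ∀ x, g x ∈ Icc (0 : ℝ) 1)
    {t : ℝ} (ht : 0 ≤ t) {r₁ r₂ : ℕ} (hr : r₁ < r₂) :
    (Measure.pi fun _ : Fin n => P)
      {x | ∃ o o', x ∈ rankEvent z r₁ r₂ o o' ∩ deviationEvent P z g t o o'} ≤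
      ENNReal.ofReal (2 * Real.exp (-2 * (r₂ - r₁ : ℕ) * t ^ 2)) := by
  set π := Measure.pi fun _ : Fin n => P
  have hU : {x | ∃ o o', x ∈ rankEvent z r₁ r₂ o o' ∩ deviationEvent P z g t o o'} =
      ⋃ q ∈ (Finset.univ : Finset (Option (Fin n) × Option (Fin n))),
        rankEvent z r₁ r₂ q.1 q.2 ∩ deviationEvent P z g t q.1 q.2 := by
    ext x; simp
  rw [hU]
  refine (measure_biUnion_finset_le _ _).trans ?_
  refine (Finset.sum_le_sum fun q _ =>
    pi_rankEvent_inter_deviationEvent_le P hz hg hg01 ht hr q.1 q.2).trans ?_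
  rw [← Finset.mul_sum]
  refine mul_le_of_le_one_right' ?_
  rw [← measure_biUnion_finset₀ ?_ fun q _ =>
    (measurableSet_rankEvent hz _ _ _ _).nullMeasurableSet]
  · exact prob_le_one
  · intro q _ q' _ hne
    have : π {x | ¬ Function.Injective (z ∘ x)} = 0 := ae_iff.1 (ae_injective_score P hz hna)
    refine measure_mono_null ?_ this
    rintro x ⟨h1, h2⟩ hinj
    refine hne (Prod.ext ?_ ?_)
    · exact leftEnd_unique hinj (fun i => hz01 _) (h1.1.trans h2.1.symm)
    · exact rightEnd_unique hinj (fun i => hz01 _) (h1.2.trans h2.2.symm)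

end RandomInterval

/-! ### Order statistics and uniform-mass bins -/

section Bins

variable {n : ℕ}

lemma orderStat_of_mem {v : Fin n → ℝ} {r : ℕ} (h1 : 1 ≤ r) (h2 : r ≤ n) :
    orderStat v r = v (Tuple.sort v ⟨r - 1, by omega⟩) := by
  rw [orderStat, dif_pos ⟨h1, h2⟩]

lemma orderStat_mem_Icc {v : Fin n → ℝ} (hv : ∀ k, v k ∈ Icc (0 : ℝ) 1) (r : ℕ) :
    orderStat v r ∈ Icc (0 : ℝ) 1 := by
  unfold orderStat
  split_ifs
  · exact hv _
  · simp

lemma orderStat_mono {v : Fin n → ℝ} (hv : ∀ k, v k ∈ Icc (0 : ℝ) 1) {r s : ℕ} (hrs : r ≤ s)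
    (hs : s ≤ n) : orderStat v r ≤ orderStat v s := by
  rcases Nat.eq_zero_or_pos r with rfl | hr
  · have : orderStat v 0 = 0 := by simp [orderStat]
    rw [this]
    exact (orderStat_mem_Icc hv s).1
  · rw [orderStat_of_mem hr (hrs.trans hs), orderStat_of_mem (hr.trans_le hrs) hs]
    refine Tuple.monotone_sort v ?_
    rw [Fin.mk_le_mk]
    omega

lemma strictMono_comp_sort {v : Fin n → ℝ} (hv : Function.Injective v) :
    StrictMono (v ∘ Tuple.sort v) :=
  (Tuple.monotone_sort v).strictMono_of_injective (hv.comp (Tuple.sort v).injective)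

/-- Without ties, exactly `r` entries are at most the `r`-th order statistic. -/
lemma cntLe_orderStat {v : Fin n → ℝ} (hv : Function.Injective v) {r : ℕ} (h1 : 1 ≤ r)
    (h2 : r ≤ n) : cntLe v (orderStat v r) = r := by
  rw [orderStat_of_mem h1 h2, cntLe]
  have : (Finset.univ.filter fun k => v k ≤ v (Tuple.sort v ⟨r - 1, by omega⟩)) =
      (Finset.Iic (⟨r - 1, by omega⟩ : Fin n)).map (Tuple.sort v).toEmbedding := by
    ext k
    simp only [Finset.mem_filter, Finset.mem_univ, true_and, Finset.mem_map_equiv, Finset.mem_Iic]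
    rw [← (strictMono_comp_sort hv).le_iff_le]
    simp
  rw [this, Finset.card_map, Fin.card_Iic]
  simp only
  omega

/-- Without ties, exactly `r - 1` entries are less than the `r`-th order statistic. -/
lemma cntLt_orderStat {v : Fin n → ℝ} (hv : Function.Injective v) {r : ℕ} (h1 : 1 ≤ r)
    (h2 : r ≤ n) : cntLt v (orderStat v r) = r - 1 := by
  rw [orderStat_of_mem h1 h2, cntLt]
  have : (Finset.univ.filter fun k => v k < v (Tuple.sort v ⟨r - 1, by omega⟩)) =
      (Finset.Iio (⟨r - 1, by omega⟩ : Fin n)).map (Tuple.sort v).toEmbedding := by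
    ext k
    simp only [Finset.mem_filter, Finset.mem_univ, true_and, Finset.mem_map_equiv, Finset.mem_Iio]
    rw [← (strictMono_comp_sort hv).lt_iff_lt]
    simp
  rw [this, Finset.card_map, Fin.card_Iio]

lemma umbEdge_zero (v : Fin n → ℝ) (B : ℕ) : umbEdge v B 0 = 0 := by simp [umbEdge]

lemma umbEdge_last {v : Fin n → ℝ} {B : ℕ} (hB : 0 < B) : umbEdge v B B = 1 := by
  simp [umbEdge, hB.ne']

lemma umbEdge_of_lt {v : Fin n → ℝ} {B b : ℕ} (hb0 : b ≠ 0) (hb : b < B) :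
    umbEdge v B b = orderStat v (n * b / B) := by
  simp [umbEdge, hb0, hb]

lemma umbEdge_mem_Icc {v : Fin n → ℝ} (hv : ∀ k, v k ∈ Icc (0 : ℝ) 1) (B b : ℕ) :
    umbEdge v B b ∈ Icc (0 : ℝ) 1 := by
  unfold umbEdge
  split_ifs
  · simp
  · simp
  · exact orderStat_mem_Icc hv _

lemma mul_div_le_of_le {B b : ℕ} (hb : b ≤ B) : n * b / B ≤ n :=
  Nat.div_le_of_le_mul (by rw [mul_comm]; exact Nat.mul_le_mul_right _ hb)

lemma umbEdge_mono {v : Fin n → ℝ} (hv : ∀ k, v k ∈ Icc (0 : ℝ) 1) (B : ℕ) :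
    Monotone (umbEdge v B) := by
  intro a b hab
  by_cases ha : a = 0
  · rw [ha, umbEdge_zero]; exact (umbEdge_mem_Icc hv B b).1
  by_cases hb : B ≤ b
  · have : umbEdge v B b = 1 := by
      rw [umbEdge, if_neg (by omega), if_pos hb]
    rw [this]; exact (umbEdge_mem_Icc hv B a).2
  rw [umbEdge_of_lt ha (by omega), umbEdge_of_lt (by omega) (by omega)]
  exact orderStat_mono hv (Nat.div_le_div_right (Nat.mul_le_mul_left _ hab))
    (mul_div_le_of_le (by omega))

lemma mem_umbBin_iff {v : Fin n → ℝ} {B b : ℕ} {s : ℝ} (hs : 0 ≤ s) :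
    s ∈ umbBin v B b ↔ (b ≠ 0 → umbEdge v B b < s) ∧ s ≤ umbEdge v B (b + 1) := by
  unfold umbBin
  split_ifs with h
  · simp [h, umbEdge_zero, hs]
  · simp [h]

lemma measurableSet_umbBin (v : Fin n → ℝ) (B b : ℕ) : MeasurableSet (umbBin v B b) := by
  unfold umbBin
  split_ifs
  · exact measurableSet_Icc
  · exact measurableSet_Ioc

lemma umbBin_subset (v : Fin n → ℝ) (B b : ℕ) :
    umbBin v B b ⊆ Icc (umbEdge v B b) (umbEdge v B (b + 1)) := by
  unfold umbBin
  split_ifs with h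
  · rw [h]
  · exact Ioc_subset_Icc_self

lemma umbBin_unique {v : Fin n → ℝ} (hv : ∀ k, v k ∈ Icc (0 : ℝ) 1) {B b c : ℕ} {s : ℝ}
    (hb : s ∈ umbBin v B b) (hc : s ∈ umbBin v B c) : b = c := by
  have hs : 0 ≤ s := (umbEdge_mem_Icc hv B b).1.trans (umbBin_subset v B b hb).1
  have haux : ∀ b c, s ∈ umbBin v B b → s ∈ umbBin v B c → ¬ b < c := by
    intro b c hb hc hbc
    rw [mem_umbBin_iff hs] at hb hc
    have := umbEdge_mono hv B (show b + 1 ≤ c from hbc)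
    linarith [hc.1 (by omega), hb.2]
  rcases lt_trichotomy b c with h | h | h
  · exact absurd h (haux b c hb hc)
  · exact h
  · exact absurd h (haux c b hc hb)

lemma exists_mem_umbBin (v : Fin n → ℝ) {B : ℕ} (hB : 0 < B) {s : ℝ}
    (hs : s ∈ Icc (0 : ℝ) 1) : ∃ b < B, s ∈ umbBin v B b := by
  have hex : ∃ b, s ≤ umbEdge v B (b + 1) := ⟨B - 1, by
    rw [Nat.sub_add_cancel hB, umbEdge_last hB]; exact hs.2⟩
  classical
  refine ⟨Nat.find hex, ?_, ?_⟩
  · have := Nat.find_min' hex (m := B - 1) (by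
      rw [Nat.sub_add_cancel hB, umbEdge_last hB]; exact hs.2)
    omega
  · rw [mem_umbBin_iff hs.1]
    refine ⟨fun h0 => ?_, Nat.find_spec hex⟩
    have := Nat.find_min hex (m := Nat.find hex - 1) (by omega)
    rw [Nat.sub_add_cancel (by omega)] at this
    exact not_le.1 this

section Recalibration

variable {𝒳 : Type*} {f : 𝒳 → ℝ}

lemma umbRecalibration_eq_of_mem (hf : ∀ x, f x ∈ Icc (0 : ℝ) 1) {D : Fin n → 𝒳 × Fin 2}
    {B b : ℕ} (hb : b < B) {s : ℝ} (hs : s ∈ umbBin (fun i => f (D i).1) B b) :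
    umbRecalibration f D B s = binMean (fun i => f (D i).1) (fun i => labelValue (D i).2)
      (umbBin (fun i => f (D i).1) B b) := by
  unfold umbRecalibration
  rw [Finset.sum_eq_single_of_mem b (Finset.mem_range.2 hb)]
  · exact indicator_of_mem hs _
  · intro c _ hcb
    refine indicator_of_notMem (fun hc => hcb ?_) _
    exact umbBin_unique (fun k => hf _) hc hs

lemma umbRecalibration_eq_zero {D : Fin n → 𝒳 × Fin 2} {B : ℕ} {s : ℝ}
    (hs : ∀ b < B, s ∉ umbBin (fun i => f (D i).1) B b) : umbRecalibration f D B s = 0 :=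
  Finset.sum_eq_zero fun b hb => indicator_of_notMem (hs b (Finset.mem_range.1 hb)) _

lemma measurable_umbRecalibration (D : Fin n → 𝒳 × Fin 2) (B : ℕ) :
    Measurable (umbRecalibration f D B) := by
  unfold umbRecalibration
  exact Finset.measurable_fun_sum _ fun b _ =>
    measurable_const.indicator (measurableSet_umbBin _ B b)

lemma labelValue_mem_Icc (y : Fin 2) : labelValue y ∈ Icc (0 : ℝ) 1 := by
  unfold labelValue
  fin_cases y <;> simp

lemma binMean_mem_Icc {v y : Fin n → ℝ} (hy : ∀ k, y k ∈ Icc (0 : ℝ) 1) (I : Set ℝ) :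
    binMean v y I ∈ Icc (0 : ℝ) 1 := by
  unfold binMean
  have h0 : 0 ≤ ∑ i, I.indicator (fun _ => y i) (v i) :=
    Finset.sum_nonneg fun i _ => indicator_nonneg (fun _ _ => (hy i).1) _
  have h1 : ∑ i, I.indicator (fun _ => y i) (v i) ≤ ∑ i, I.indicator (fun _ => (1 : ℝ)) (v i) :=
    Finset.sum_le_sum fun i _ => indicator_le_indicator (hy i).2
  exact ⟨div_nonneg h0 (h0.trans h1), div_le_one_of_le₀ h1 (h0.trans h1)⟩

lemma umbRecalibration_mem_Icc (hf : ∀ x, f x ∈ Icc (0 : ℝ) 1) (D : Fin n → 𝒳 × Fin 2)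
    (B : ℕ) (s : ℝ) : umbRecalibration f D B s ∈ Icc (0 : ℝ) 1 := by
  by_cases h : ∃ b < B, s ∈ umbBin (fun i => f (D i).1) B b
  · obtain ⟨b, hb, hs⟩ := h
    rw [umbRecalibration_eq_of_mem hf hb hs]
    exact binMean_mem_Icc (fun k => labelValue_mem_Icc _) _
  · push Not at h
    rw [umbRecalibration_eq_zero h]
    simp

end Recalibration

section Ranks

/-- Without ties, the break point `u_b` has rank `⌊n b / B⌋`. -/
lemma cntLe_umbEdge {v : Fin n → ℝ} (hv : Function.Injective v) (hv01 : ∀ k, v k ∈ Ioc (0 : ℝ) 1)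
    {B b : ℕ} (hB : 0 < B) (hBn : B ≤ n) (hb : b ≤ B) : cntLe v (umbEdge v B b) = n * b / B := by
  by_cases hb0 : b = 0
  · subst hb0
    rw [umbEdge_zero, cntLe, mul_zero, Nat.zero_div, Finset.card_eq_zero,
      Finset.filter_eq_empty_iff]
    exact fun k _ => not_le.2 (hv01 k).1
  rcases hb.lt_or_eq with hlt | rfl
  · rw [umbEdge_of_lt hb0 hlt]
    refine cntLe_orderStat hv ?_ (mul_div_le_of_le hb)
    rw [Nat.le_div_iff_mul_le hB, one_mul]
    exact hBn.trans (Nat.le_mul_of_pos_right n (by omega))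
  · rw [umbEdge_last hB, Nat.mul_div_cancel _ hB, cntLe, Finset.filter_true_of_mem]
    · simp
    · exact fun k _ => (hv01 k).2

lemma le_mul_succ_div_sub {B : ℕ} (n b : ℕ) :
    n * b / B + n / B ≤ n * (b + 1) / B := by
  rw [mul_add, mul_one]
  exact Nat.div_add_div_le_add_div

/-- Every bin is an open random interval with end points of prescribed ranks, up to its right end
point, which is one of the scores unless the bin is the last one. -/
lemma exists_ends_umbBin {v : Fin n → ℝ} (hv : Function.Injective v)
    (hv01 : ∀ k, v k ∈ Ioc (0 : ℝ) 1) {B b : ℕ} (hBn : B ≤ n) (hb : b < B) :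
    ∃ o o' : Option (Fin n), cntLe v (leftEnd v o) = n * b / B ∧
      cntLt v (rightEnd v o') = (if b + 1 = B then n else n * (b + 1) / B - 1) ∧
      ∀ s ∈ Icc (0 : ℝ) 1, s ∈ umbBin v B b ↔
        s ∈ Ioo (leftEnd v o) (rightEnd v o') ∨ (leftEnd v o < s ∧ ∃ j, o' = some j ∧ s = v j) := by
  have hB : 0 < B := by omega
  have hrank : ∀ c, c ≠ 0 → 1 ≤ n * c / B := fun c hc => by
    rw [Nat.le_div_iff_mul_le hB, one_mul]
    exact hBn.trans (Nat.le_mul_of_pos_right n (by omega))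
  obtain ⟨o, ho1, ho2⟩ : ∃ o : Option (Fin n), cntLe v (leftEnd v o) = n * b / B ∧
      ∀ s ∈ Icc (0 : ℝ) 1, (b ≠ 0 → umbEdge v B b < s) ↔ leftEnd v o < s := by
    by_cases hb0 : b = 0
    · refine ⟨none, ?_, fun s hs => ?_⟩
      · rw [hb0, mul_zero, Nat.zero_div, cntLe, Finset.card_eq_zero, Finset.filter_eq_empty_iff]
        intro k _
        have := (hv01 k).1
        simp only [leftEnd, Option.elim, not_le]
        linarith
      · have := hs.1
        simp only [leftEnd, Option.elim, hb0, ne_eq, not_true_eq_false, false_imp_iff, true_iff]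
        linarith
    · refine ⟨some (Tuple.sort v ⟨n * b / B - 1, by
        have := hrank b hb0; have := mul_div_le_of_le (n := n) hb.le; omega⟩), ?_, ?_⟩
      · have := cntLe_umbEdge hv hv01 hB hBn hb.le
        rwa [umbEdge_of_lt hb0 hb,
          orderStat_of_mem (hrank b hb0) (mul_div_le_of_le hb.le)] at this
      · intro s _
        rw [umbEdge_of_lt hb0 hb, orderStat_of_mem (hrank b hb0) (mul_div_le_of_le hb.le)]
        simp [leftEnd, hb0]
  by_cases hlast : b + 1 = B
  · refine ⟨o, none, ho1, ?_, fun s hs => ?_⟩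
    · rw [if_pos hlast, cntLt, Finset.filter_true_of_mem]
      · simp
      · intro k _
        have := (hv01 k).2
        simp only [rightEnd, Option.elim]
        linarith
    · rw [mem_umbBin_iff hs.1, ho2 s hs, hlast, umbEdge_last hB]
      have h2 : s < rightEnd v none := by
        have := hs.2
        simp only [rightEnd, Option.elim]
        linarith
      simp [hs.2, h2]
  · have hb1 : b + 1 < B := by omega
    refine ⟨o, some (Tuple.sort v ⟨n * (b + 1) / B - 1, by
        have := hrank (b + 1) (by omega)
        have := mul_div_le_of_le (n := n) hb1.le
        omega⟩), ho1, ?_, fun s hs => ?_⟩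
    · have := cntLt_orderStat hv (hrank (b + 1) (by omega)) (mul_div_le_of_le hb1.le)
      rw [orderStat_of_mem (hrank (b + 1) (by omega)) (mul_div_le_of_le hb1.le)] at this
      rw [if_neg hlast]
      exact this
    · rw [mem_umbBin_iff hs.1, ho2 s hs, umbEdge_of_lt (by omega) hb1,
        orderStat_of_mem (hrank (b + 1) (by omega)) (mul_div_le_of_le hb1.le)]
      simp only [rightEnd, Option.elim, mem_Ioo, Option.some.injEq, exists_eq_left',
        le_iff_lt_or_eq, and_or_left]

/-- If each cell of a grid of `B` quantiles contains at least half of its expected number of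
scores, then every bin has mass at most `4 / B`: a heavier bin would contain three cells, hence more
scores than there are in a bin. -/
lemma umbBin_mass_le {v : Fin n → ℝ} (hv : Function.Injective v)
    (hv01 : ∀ k, v k ∈ Ioc (0 : ℝ) 1) {B b : ℕ} (hB : 0 < B) (hBn : 2 * (B : ℝ) < n) (hb : b < B)
    {F : ℝ → ℝ} (hF : Monotone F) (hF01 : ∀ s, F s ∈ Icc (0 : ℝ) 1) {q : ℕ → ℝ}
    (hq : ∀ l ≤ B, F (q l) = l / B)
    (hgrid : ∀ l < B, (n : ℝ) / (2 * B) ≤ (cntLe v (q (l + 1)) : ℝ) - cntLe v (q l)) :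
    F (umbEdge v B (b + 1)) - F (umbEdge v B b) ≤ 4 / B := by
  by_contra! hcon
  have hB' : (0 : ℝ) < B := by exact_mod_cast hB
  have hBn' : B ≤ n := by
    have : (B : ℝ) ≤ n := by linarith
    exact_mod_cast this
  set u := umbEdge v B b
  set w := umbEdge v B (b + 1)
  set l := ⌊B * F u⌋₊ + 1 with hl
  have hBu : 0 ≤ B * F u := mul_nonneg hB'.le (hF01 u).1
  have hl1 : B * F u < l := by rw [hl]; push_cast; exact Nat.lt_floor_add_one _
  have hl2 : (l : ℝ) ≤ B * F u + 1 := by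
    rw [hl]; push_cast; linarith [Nat.floor_le hBu]
  have hcon' : 4 < B * F w - B * F u := by
    rw [div_lt_iff₀ hB'] at hcon; linarith
  have hw : B * F w ≤ B := by nlinarith [(hF01 w).2]
  have hl3 : l + 3 ≤ B := by
    have : ((l + 3 : ℕ) : ℝ) < B := by push_cast; linarith
    exact_mod_cast this.le
  have huq : u ≤ q l := by
    refine le_of_lt (hF.reflect_lt ?_)
    rw [hq l (by omega), lt_div_iff₀ hB']
    linarith
  have hqw : q (l + 3) ≤ w := by
    refine le_of_lt (hF.reflect_lt ?_)
    rw [hq _ hl3, div_lt_iff₀ hB']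
    push_cast; linarith
  have hmono : Monotone fun a => cntLe v a := fun a a' haa => by
    refine Finset.card_le_card fun k hk => ?_
    simp only [Finset.mem_filter, Finset.mem_univ, true_and] at hk ⊢
    exact hk.trans haa
  have h1 : (cntLe v u : ℝ) ≤ cntLe v (q l) := by exact_mod_cast hmono huq
  have h2 : (cntLe v (q (l + 3)) : ℝ) ≤ cntLe v w := by exact_mod_cast hmono hqw
  have g1 := hgrid l (by omega)
  have g2 := hgrid (l + 1) (by omega)
  have g3 := hgrid (l + 2) (by omega)
  rw [cntLe_umbEdge hv hv01 hB hBn' hb.le] at h1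
  rw [cntLe_umbEdge hv hv01 hB hBn' hb] at h2
  have d1 : ((n * (b + 1) / B : ℕ) : ℝ) ≤ (n * (b + 1) : ℝ) / B := by
    have := @Nat.cast_div_le ℝ _ _ _ (n * (b + 1)) B
    push_cast at this; exact this
  have d2 : (n * b : ℝ) / B < ((n * b / B : ℕ) : ℝ) + 1 := by
    rw [div_lt_iff₀ hB']
    have := Nat.lt_div_mul_add (a := n * b) hB
    have h : n * b < (n * b / B + 1) * B := by rw [add_mul, one_mul]; exact this
    exact_mod_cast h
  have d3 : (n * (b + 1) : ℝ) / B = (n * b : ℝ) / B + n / B := by ring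
  have d4 : (2 : ℝ) < n / B := by rw [lt_div_iff₀ hB']; exact hBn
  have d5 : (n : ℝ) / (2 * B) = n / B / 2 := by ring
  rw [d5] at g1 g2 g3
  have e1 : l + 1 + 1 = l + 2 := rfl
  have e2 : l + 2 + 1 = l + 3 := rfl
  rw [e1] at g2
  rw [e2] at g3
  linarith

end Ranks

end Bins

/-! ### Label shift and the deterministic bound -/

section Correction

lemma shiftCorrection_denom_ge {w : Fin 2 → ℝ} {z : ℝ} (hz : z ∈ Icc (0 : ℝ) 1) :
    min (w 0) (w 1) ≤ w 1 * z + w 0 * (1 - z) := by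
  have h1 := mul_le_mul_of_nonneg_right (min_le_right (w 0) (w 1)) hz.1
  have h0 := mul_le_mul_of_nonneg_right (min_le_left (w 0) (w 1)) (sub_nonneg.2 hz.2)
  linarith

lemma shiftCorrection_mem_Icc {w : Fin 2 → ℝ} (hw : ∀ k, 0 ≤ w k) {z : ℝ}
    (hz : z ∈ Icc (0 : ℝ) 1) : shiftCorrection w z ∈ Icc (0 : ℝ) 1 := by
  have h1 : 0 ≤ w 1 * z := mul_nonneg (hw 1) hz.1
  have h0 : 0 ≤ w 0 * (1 - z) := mul_nonneg (hw 0) (sub_nonneg.2 hz.2)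
  exact ⟨div_nonneg h1 (add_nonneg h1 h0), div_le_one_of_le₀ (by linarith) (add_nonneg h1 h0)⟩

lemma measurable_shiftCorrection (w : Fin 2 → ℝ) : Measurable (shiftCorrection w) := by
  unfold shiftCorrection
  fun_prop

/-- The shift correction is Lipschitz with constant `max w / min w`. -/
lemma abs_shiftCorrection_sub_le {w : Fin 2 → ℝ} (hw : ∀ k, 0 < w k) {z z' : ℝ}
    (hz : z ∈ Icc (0 : ℝ) 1) (hz' : z' ∈ Icc (0 : ℝ) 1) :
    |shiftCorrection w z - shiftCorrection w z'| ≤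
      max (w 0) (w 1) / min (w 0) (w 1) * |z - z'| := by
  have hm : 0 < min (w 0) (w 1) := lt_min (hw 0) (hw 1)
  have hM : 0 ≤ max (w 0) (w 1) := le_max_of_le_left (hw 0).le
  have hd := shiftCorrection_denom_ge (w := w) hz
  have hd' := shiftCorrection_denom_ge (w := w) hz'
  set d := w 1 * z + w 0 * (1 - z) with hdd
  set d' := w 1 * z' + w 0 * (1 - z') with hdd'
  have hdpos := hm.trans_le hd
  have hdpos' := hm.trans_le hd'
  have hdiff : shiftCorrection w z - shiftCorrection w z' =
      max (w 0) (w 1) * min (w 0) (w 1) / (d * d') * (z - z') := by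
    rw [max_mul_min]
    unfold shiftCorrection
    rw [← hdd, ← hdd', div_sub_div _ _ hdpos.ne' hdpos'.ne', div_mul_eq_mul_div]
    congr 1
    rw [hdd, hdd']; ring
  rw [hdiff, abs_mul, abs_of_nonneg (by positivity)]
  refine mul_le_mul_of_nonneg_right ?_ (abs_nonneg _)
  rw [div_le_div_iff₀ (by positivity) hm, mul_assoc]
  exact mul_le_mul_of_nonneg_left (mul_le_mul hd hd' hm.le hdpos.le) hM

/-- Rescaling the weights by factors `ρ₀` and `ρ₁` changes the shift correction by at most
`|ρ₀ - ρ₁| / (ρ₀ + ρ₁)`. -/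
lemma abs_shiftCorrection_rescale_sub_le {w ρ : Fin 2 → ℝ} (hw : ∀ k, 0 < w k)
    (hρ : ∀ k, 0 ≤ ρ k) (hρs : 0 < ρ 0 + ρ 1) {z : ℝ} (hz : z ∈ Icc (0 : ℝ) 1) :
    |shiftCorrection (fun k => ρ k * w k) z - shiftCorrection w z| ≤
      |(ρ 0 - ρ 1) / (ρ 0 + ρ 1)| := by
  have ha : 0 ≤ w 1 * z := mul_nonneg (hw 1).le hz.1
  have hb : 0 ≤ w 0 * (1 - z) := mul_nonneg (hw 0).le (sub_nonneg.2 hz.2)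
  have hd := (lt_min (hw 0) (hw 1)).trans_le (shiftCorrection_denom_ge (w := w) hz)
  unfold shiftCorrection
  simp only [mul_assoc]
  set a := w 1 * z
  set b := w 0 * (1 - z)
  have h0 := hρ 0
  have h1 := hρ 1
  rcases (add_nonneg (mul_nonneg h1 ha) (mul_nonneg h0 hb)).eq_or_lt' with hD | hD
  · -- degenerate case: the rescaled quotient has the value `0`
    rw [hD, div_zero, zero_sub, abs_neg]
    have hρa : ρ 1 * a = 0 := by nlinarith [mul_nonneg h1 ha, mul_nonneg h0 hb]
    have hρb : ρ 0 * b = 0 := by nlinarith [mul_nonneg h1 ha, mul_nonneg h0 hb]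
    rcases mul_eq_zero.1 hρa with h | h
    · rw [h, sub_zero, add_zero, div_self (by linarith), abs_one, abs_of_nonneg (by positivity)]
      exact div_le_one_of_le₀ (by linarith) hd.le
    · rw [h, zero_div, abs_zero]; exact abs_nonneg _
  · have hdiff : ρ 1 * a / (ρ 1 * a + ρ 0 * b) - a / (a + b) =
        -(a * b * (ρ 0 - ρ 1) / ((ρ 1 * a + ρ 0 * b) * (a + b))) := by
      field_simp
      ring
    rw [hdiff, abs_neg, abs_div, abs_div, abs_mul, abs_of_nonneg (mul_nonneg ha hb),
      abs_of_pos hρs, abs_of_pos (mul_pos hD hd), div_le_div_iff₀ (mul_pos hD hd) hρs,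
      mul_comm (a * b), mul_assoc]
    refine mul_le_mul_of_nonneg_left ?_ (abs_nonneg _)
    nlinarith [mul_nonneg h1 (sq_nonneg a), mul_nonneg h0 (sq_nonneg b)]

end Correction

section EmpiricalFrequencies

variable {𝒳 : Type*}

lemma empClassProb_nonneg {n : ℕ} (D : Fin n → 𝒳 × Fin 2) (k : Fin 2) : 0 ≤ empClassProb D k := by
  unfold empClassProb; positivity

lemma empClassProb_add {n : ℕ} (hn : 0 < n) (D : Fin n → 𝒳 × Fin 2) :
    empClassProb D 0 + empClassProb D 1 = 1 := by
  have hn' : (n : ℝ) ≠ 0 := by exact_mod_cast hn.ne'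
  unfold empClassProb
  rw [← add_div, div_eq_one_iff_eq hn', ← Nat.cast_add, Finset.card_filter, Finset.card_filter,
    ← Finset.sum_add_distrib]
  congr 1
  rw [Finset.sum_congr rfl (g := fun _ => 1)]
  · simp
  · intro i _
    generalize (D i).2 = y
    fin_cases y <;> simp

end EmpiricalFrequencies

section Population

variable {𝒳 : Type*} [MeasurableSpace 𝒳] {P Q : Measure (𝒳 × Fin 2)}

lemma measurableSet_label (k : Fin 2) : MeasurableSet {ω : 𝒳 × Fin 2 | ω.2 = k} :=
  measurable_snd (measurableSet_singleton k)

lemma measurable_labelValue : Measurable fun ω : 𝒳 × Fin 2 => labelValue ω.2 :=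
  (measurable_of_finite labelValue).comp measurable_snd

lemma classProb_add [IsProbabilityMeasure P] : classProb P 0 + classProb P 1 = 1 := by
  have h : {ω : 𝒳 × Fin 2 | ω.2 = 0} = {ω | ω.2 = 1}ᶜ := by
    ext ω
    obtain ⟨x, y⟩ := ω
    fin_cases y <;> simp
  unfold classProb
  rw [h, measureReal_compl (measurableSet_label 1)]
  simp

lemma classProb_pos [IsProbabilityMeasure P] (h : classProb P 1 ∈ Ioo (0 : ℝ) 1) (k : Fin 2) :
    0 < classProb P k := by
  have := classProb_add (P := P)
  fin_cases k
  · change 0 < classProb P 0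
    linarith [h.2]
  · exact h.1

lemma measurable_weight : Measurable fun ω : 𝒳 × Fin 2 => trueWeight P Q ω.2 :=
  (measurable_of_finite (trueWeight P Q)).comp measurable_snd

lemma trueWeight_le_maxWeight (k : Fin 2) : trueWeight P Q k ≤ maxWeight P Q := by
  fin_cases k
  · exact le_max_left _ _
  · exact le_max_right _ _

lemma trueWeight_eq (ω : 𝒳 × Fin 2) : trueWeight P Q ω.2 =
    trueWeight P Q 1 * labelValue ω.2 + trueWeight P Q 0 * (1 - labelValue ω.2) := by
  obtain ⟨x, y⟩ := ω
  fin_cases y <;> simp [labelValue]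

section Shift

variable [IsProbabilityMeasure P] [IsProbabilityMeasure Q]

lemma trueWeight_pos (hPQ : LabelShift P Q) (k : Fin 2) : 0 < trueWeight P Q k :=
  div_pos (classProb_pos hPQ.target_mem k) (classProb_pos hPQ.source_mem k)

lemma measure_inter_label (hPQ : LabelShift P Q) {A : Set (𝒳 × Fin 2)} (hA : MeasurableSet A)
    (k : Fin 2) :
    Q ({ω | ω.2 = k} ∩ A) = ENNReal.ofReal (trueWeight P Q k) * P ({ω | ω.2 = k} ∩ A) := by
  have hS : MeasurableSet {x | (x, k) ∈ A} := measurable_prodMk_right hA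
  have hAk : {ω | ω.2 = k} ∩ A = {ω | ω.2 = k} ∩ {ω | ω.1 ∈ {x | (x, k) ∈ A}} := by
    ext ⟨x, y⟩
    simp only [mem_inter_iff, mem_ofPred_eq, and_congr_right_iff]
    rintro rfl; rfl
  have h := hPQ.cond_eq k _ hS
  rw [cond_apply (measurableSet_label k), cond_apply (measurableSet_label k), ← hAk] at h
  have hp := classProb_pos hPQ.source_mem k
  have hq := classProb_pos hPQ.target_mem k
  have hQ0 : Q {ω | ω.2 = k} ≠ 0 := fun h0 => by
    simp [classProb, measureReal_def, h0] at hq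
  rw [trueWeight, ENNReal.ofReal_div_of_pos hp, classProb, classProb, ofReal_measureReal,
    ofReal_measureReal, ENNReal.div_eq_inv_mul, mul_comm _ (Q _), mul_assoc, h, ← mul_assoc,
    ENNReal.mul_inv_cancel hQ0 (measure_ne_top _ _), one_mul]

/-- Under label shift, the density of the target with respect to the source is the true weight of
the label. -/
lemma target_eq_withDensity (hPQ : LabelShift P Q) :
    Q = P.withDensity fun ω => ENNReal.ofReal (trueWeight P Q ω.2) := by
  have hlab : ∀ A : Set (𝒳 × Fin 2), ⋃ k, ({ω : 𝒳 × Fin 2 | ω.2 = k} ∩ A) = A := by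
    intro A; ext; simp
  have hdisj : ∀ A : Set (𝒳 × Fin 2),
      Pairwise (Function.onFun Disjoint fun k => {ω : 𝒳 × Fin 2 | ω.2 = k} ∩ A) :=
    fun A i j hij => Set.disjoint_left.2 fun ω hi hj => hij (hi.1.symm.trans hj.1)
  ext A hA
  have hm : ∀ k, MeasurableSet ({ω : 𝒳 × Fin 2 | ω.2 = k} ∩ A) :=
    fun k => (measurableSet_label k).inter hA
  rw [← hlab A, measure_iUnion (hdisj A) hm, measure_iUnion (hdisj A) hm]
  congr 1
  funext k
  rw [measure_inter_label hPQ hA, withDensity_apply _ (hm k),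
    setLIntegral_congr_fun (hm k) (g := fun _ => ENNReal.ofReal (trueWeight P Q k))
      (fun ω hω => by rw [show ω.2 = k from hω.1]), setLIntegral_const]

lemma setIntegral_target (hPQ : LabelShift P Q) (φ : 𝒳 × Fin 2 → ℝ) {s : Set (𝒳 × Fin 2)}
    (hs : MeasurableSet s) :
    ∫ ω in s, φ ω ∂Q = ∫ ω in s, trueWeight P Q ω.2 * φ ω ∂P := by
  conv_lhs => rw [target_eq_withDensity hPQ]
  rw [setIntegral_withDensity_eq_setIntegral_toReal_smul measurable_weight.ennreal_ofReal
    (ae_of_all _ fun _ => ENNReal.ofReal_lt_top) _ hs]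
  refine setIntegral_congr_fun hs fun ω _ => ?_
  simp only [smul_eq_mul]
  rw [ENNReal.toReal_ofReal (trueWeight_pos hPQ _).le]

end Shift

section CondLabel

variable {f : 𝒳 → ℝ}

lemma measurable_score (hf : Measurable f) : Measurable fun ω : 𝒳 × Fin 2 => f ω.1 :=
  hf.comp measurable_fst

lemma condLabel_mem_Icc [IsProbabilityMeasure P] (hf : Measurable f) :
    ∀ᵐ ω ∂P, condLabel P f ω ∈ Icc (0 : ℝ) 1 := by
  have hi : Integrable (fun ω : 𝒳 × Fin 2 => labelValue ω.2) P :=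
    integrable_of_mem_Icc measurable_labelValue fun ω => labelValue_mem_Icc _
  have h0 := condExp_nonneg (m := MeasurableSpace.comap (fun ω : 𝒳 × Fin 2 => f ω.1) inferInstance)
    (μ := P) (f := fun ω : 𝒳 × Fin 2 => labelValue ω.2)
    (ae_of_all _ fun ω => (labelValue_mem_Icc ω.2).1)
  have h1 := condExp_mono (m := MeasurableSpace.comap (fun ω : 𝒳 × Fin 2 => f ω.1) inferInstance)
    (μ := P) hi (integrable_const (1 : ℝ)) (ae_of_all _ fun ω => (labelValue_mem_Icc ω.2).2)
  rw [condExp_const (measurable_score hf).comap_le] at h1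
  filter_upwards [h0, h1] with ω hω0 hω1 using ⟨hω0, hω1⟩

/-- The conditional expectation `E_P[Y | f(X)]`, clipped to `[0, 1]`. -/
noncomputable def clippedCondLabel (P : Measure (𝒳 × Fin 2)) (f : 𝒳 → ℝ) (ω : 𝒳 × Fin 2) : ℝ :=
  max 0 (min 1 (condLabel P f ω))

lemma clippedCondLabel_mem_Icc (ω : 𝒳 × Fin 2) : clippedCondLabel P f ω ∈ Icc (0 : ℝ) 1 :=
  ⟨le_max_left _ _, max_le zero_le_one (min_le_left _ _)⟩

lemma clippedCondLabel_ae_eq [IsProbabilityMeasure P] (hf : Measurable f) :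
    clippedCondLabel P f =ᵐ[P] condLabel P f := by
  filter_upwards [condLabel_mem_Icc (P := P) hf] with ω hω
  rw [clippedCondLabel, min_eq_right hω.2, max_eq_right hω.1]

lemma measurable_clippedCondLabel :
    Measurable[MeasurableSpace.comap (fun ω : 𝒳 × Fin 2 => f ω.1) inferInstance]
      (clippedCondLabel P f) := by
  have h : Measurable[MeasurableSpace.comap (fun ω : 𝒳 × Fin 2 => f ω.1) inferInstance]
    (condLabel P f) := stronglyMeasurable_condExp.measurable
  exact measurable_const.max (measurable_const.min h)

/-- The defining property of `E_P[Y | f(X)]`, tested against a function of the score. -/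
lemma setIntegral_mul_condLabel [IsProbabilityMeasure P] (hf : Measurable f)
    {φ : 𝒳 × Fin 2 → ℝ} {a b : ℝ}
    (hφ : Measurable[MeasurableSpace.comap (fun ω : 𝒳 × Fin 2 => f ω.1) inferInstance] φ)
    (hφab : ∀ ω, φ ω ∈ Icc a b) {s : Set (𝒳 × Fin 2)}
    (hs : MeasurableSet[MeasurableSpace.comap (fun ω : 𝒳 × Fin 2 => f ω.1) inferInstance] s) :
    ∫ ω in s, φ ω * clippedCondLabel P f ω ∂P = ∫ ω in s, φ ω * labelValue ω.2 ∂P := by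
  have hle := (measurable_score (𝒳 := 𝒳) hf).comap_le
  have hi : Integrable (fun ω : 𝒳 × Fin 2 => labelValue ω.2) P :=
    integrable_of_mem_Icc measurable_labelValue fun ω => labelValue_mem_Icc _
  have hφi : Integrable (φ * fun ω : 𝒳 × Fin 2 => labelValue ω.2) P := by
    refine hi.bdd_mul (c := max |a| |b|) (hφ.mono hle le_rfl).aestronglyMeasurable
      (ae_of_all _ fun ω => ?_)
    exact abs_le_max_abs_abs (hφab ω).1 (hφab ω).2
  have key := condExp_mul_of_stronglyMeasurable_left (μ := P) hφ.stronglyMeasurable hφi hi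
  calc ∫ ω in s, φ ω * clippedCondLabel P f ω ∂P
      = ∫ ω in s, (condExp (MeasurableSpace.comap (fun ω : 𝒳 × Fin 2 => f ω.1) inferInstance) P
          (φ * fun ω : 𝒳 × Fin 2 => labelValue ω.2)) ω ∂P := by
        refine setIntegral_congr_ae (hle s hs) ?_
        filter_upwards [key, clippedCondLabel_ae_eq (P := P) hf] with ω h1 h2 _
        rw [h1, h2]; rfl
    _ = ∫ ω in s, φ ω * labelValue ω.2 ∂P := by
        rw [setIntegral_condExp hle hφi hs]; rfl

variable [IsProbabilityMeasure P] [IsProbabilityMeasure Q]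

/-- Under label shift, `E_Q[Y | f(X)]` is the shift correction of `E_P[Y | f(X)]` with the true
weights: both have the same integrals over the events generated by the score. -/
lemma condLabel_target_ae_eq (hf : Measurable f) (hPQ : LabelShift P Q) :
    (fun ω => shiftCorrection (trueWeight P Q) (clippedCondLabel P f ω)) =ᵐ[Q] condLabel Q f := by
  have hle := (measurable_score (𝒳 := 𝒳) hf).comap_le
  set w := trueWeight P Q with hw
  set r := clippedCondLabel P f with hr
  have hr01 : ∀ ω, r ω ∈ Icc (0 : ℝ) 1 := clippedCondLabel_mem_Icc
  have hrm := measurable_clippedCondLabel (P := P) (f := f)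
  have hrm' : Measurable r := hrm.mono hle le_rfl
  have hwpos := trueWeight_pos hPQ
  have hGm : Measurable[MeasurableSpace.comap (fun ω : 𝒳 × Fin 2 => f ω.1) inferInstance]
      fun ω => shiftCorrection w (r ω) := (measurable_shiftCorrection w).comp hrm
  have hGm' := hGm.mono hle le_rfl
  have hG01 : ∀ ω, shiftCorrection w (r ω) ∈ Icc (0 : ℝ) 1 :=
    fun ω => shiftCorrection_mem_Icc (fun k => (hwpos k).le) (hr01 ω)
  have hym := measurable_labelValue (𝒳 := 𝒳)
  have hy01 : ∀ ω : 𝒳 × Fin 2, labelValue ω.2 ∈ Icc (0 : ℝ) 1 := fun ω => labelValue_mem_Icc _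
  refine ae_eq_condExp_of_forall_setIntegral_eq hle (integrable_of_mem_Icc hym hy01)
    (fun s _ _ => (integrable_of_mem_Icc hGm' hG01).integrableOn) (fun s hs _ => ?_)
    hGm.stronglyMeasurable.aestronglyMeasurable
  have hs' := hle s hs
  rw [setIntegral_target hPQ _ hs', setIntegral_target hPQ _ hs', ← hw]
  have hprod : ∀ {φ ψ : 𝒳 × Fin 2 → ℝ}, Measurable φ → Measurable ψ →
      (∀ ω, φ ω ∈ Icc (0 : ℝ) 1) → (∀ ω, ψ ω ∈ Icc (0 : ℝ) 1) →
      IntegrableOn (fun ω => φ ω * ψ ω) s P := fun hφ hψ h1 h2 =>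
    (integrable_of_mem_Icc (hφ.mul hψ) fun ω =>
      ⟨mul_nonneg (h1 ω).1 (h2 ω).1, mul_le_one₀ (h1 ω).2 (h2 ω).1 (h2 ω).2⟩).integrableOn
  have hGi : IntegrableOn (fun ω => shiftCorrection w (r ω)) s P :=
    (integrable_of_mem_Icc hGm' hG01).integrableOn
  -- the weighted integral is affine in the label, which may be replaced by its conditional mean
  have hsplit : ∀ {ψ : 𝒳 × Fin 2 → ℝ}, Measurable ψ → (∀ ω, ψ ω ∈ Icc (0 : ℝ) 1) →
      ∫ ω in s, (w 1 * (shiftCorrection w (r ω) * ψ ω) +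
        (w 0 * shiftCorrection w (r ω) - w 0 * (shiftCorrection w (r ω) * ψ ω))) ∂P =
      w 1 * ∫ ω in s, shiftCorrection w (r ω) * ψ ω ∂P +
        (w 0 * ∫ ω in s, shiftCorrection w (r ω) ∂P -
          w 0 * ∫ ω in s, shiftCorrection w (r ω) * ψ ω ∂P) := fun hψ h => by
    have h1 := hprod hGm' hψ hG01 h
    have h2 : IntegrableOn (fun ω => w 0 * shiftCorrection w (r ω) -
        w 0 * (shiftCorrection w (r ω) * _)) s P := (hGi.const_mul _).sub (h1.const_mul _)
    rw [integral_add (h1.const_mul _) h2, integral_sub (hGi.const_mul _) (h1.const_mul _)]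
    simp only [integral_const_mul]
  calc ∫ ω in s, w ω.2 * shiftCorrection w (r ω) ∂P
      = ∫ ω in s, (w 1 * (shiftCorrection w (r ω) * labelValue ω.2) +
        (w 0 * shiftCorrection w (r ω) -
          w 0 * (shiftCorrection w (r ω) * labelValue ω.2))) ∂P := by
        refine setIntegral_congr_fun hs' fun ω _ => ?_
        simp only [hw]
        rw [trueWeight_eq ω]; ring
    _ = ∫ ω in s, (w 1 * (shiftCorrection w (r ω) * r ω) +
        (w 0 * shiftCorrection w (r ω) - w 0 * (shiftCorrection w (r ω) * r ω))) ∂P := by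
        rw [hsplit hym hy01, hsplit hrm' hr01, hr, setIntegral_mul_condLabel hf hGm hG01 hs]
    _ = ∫ ω in s, w 1 * (1 * r ω) ∂P := by
        refine setIntegral_congr_fun hs' fun ω _ => ?_
        have hd := (lt_min (hwpos 0) (hwpos 1)).trans_le
          (shiftCorrection_denom_ge (w := w) (hr01 ω))
        have h : shiftCorrection w (r ω) * (w 1 * r ω + w 0 * (1 - r ω)) = w 1 * r ω :=
          div_mul_cancel₀ _ hd.ne'
        linarith
    _ = ∫ ω in s, w 1 * (1 * labelValue ω.2) ∂P := by
        rw [integral_const_mul (w 1) fun ω => 1 * r ω,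
          integral_const_mul (w 1) fun ω : 𝒳 × Fin 2 => 1 * labelValue ω.2, hr,
          setIntegral_mul_condLabel hf (φ := fun _ => 1) (a := 1) (b := 1) measurable_const
            (by simp) hs]
    _ = ∫ ω in s, w ω.2 * labelValue ω.2 ∂P := by
        refine setIntegral_congr_fun hs' fun ω _ => ?_
        obtain ⟨x, y⟩ := ω
        fin_cases y <;> simp [labelValue]

end CondLabel

section Deterministic

variable {f : 𝒳 → ℝ} [IsProbabilityMeasure P] [IsProbabilityMeasure Q]

/-- The deterministic bound for the composite of an estimated shift correction and a recalibration
function that is accurate under the source. -/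
lemma risk_comp_le (hf : Measurable f) (hf01 : ∀ x, f x ∈ Icc (0 : ℝ) 1) (hPQ : LabelShift P Q)
    {ρ : Fin 2 → ℝ} (hρ : ∀ k, 0 ≤ ρ k) (hρs : 0 < ρ 0 + ρ 1) {h : ℝ → ℝ} (hh : Measurable h)
    (hh01 : ∀ z ∈ Icc (0 : ℝ) 1, h z ∈ Icc (0 : ℝ) 1) :
    risk Q f (shiftCorrection (fun k => ρ k * trueWeight P Q k) ∘ h) ≤
      2 * (((ρ 0 - ρ 1) / (ρ 0 + ρ 1)) ^ 2 +
        maxWeight P Q ^ 3 / minWeight P Q ^ 2 * risk P f h) := by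
  have hwpos := trueWeight_pos hPQ
  have hle := (measurable_score (𝒳 := 𝒳) hf).comap_le
  set r := clippedCondLabel P f
  have hr01 : ∀ ω, r ω ∈ Icc (0 : ℝ) 1 := clippedCondLabel_mem_Icc
  have hrm : Measurable r := measurable_clippedCondLabel.mono hle le_rfl
  have hhf : Measurable fun ω : 𝒳 × Fin 2 => h (f ω.1) := hh.comp (measurable_score hf)
  have hh' : ∀ ω : 𝒳 × Fin 2, h (f ω.1) ∈ Icc (0 : ℝ) 1 := fun ω => hh01 _ (hf01 _)
  set M := maxWeight P Q with hM
  set m := minWeight P Q with hm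
  have hm0 : 0 < m := lt_min (hwpos 0) (hwpos 1)
  have hM0 : 0 < M := lt_max_of_lt_left (hwpos 0)
  set D := (ρ 0 - ρ 1) / (ρ 0 + ρ 1)
  have hsq : ∀ ω, (h (f ω.1) - r ω) ^ 2 ∈ Icc (0 : ℝ) 1 := fun ω => by
    have h1 := hh' ω
    have h2 := hr01 ω
    refine ⟨sq_nonneg _, ?_⟩
    rw [sq_le_one_iff_abs_le_one, abs_le]
    constructor <;> linarith [h1.1, h1.2, h2.1, h2.2]
  have hsqm : Measurable fun ω => (h (f ω.1) - r ω) ^ 2 := (hhf.sub hrm).pow_const 2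
  have hQi := integrable_of_mem_Icc (P := Q) hsqm hsq
  have hPi := integrable_of_mem_Icc (P := P) hsqm hsq
  have hpt : ∀ ω, (shiftCorrection (fun k => ρ k * trueWeight P Q k) (h (f ω.1)) -
      shiftCorrection (trueWeight P Q) (r ω)) ^ 2 ≤
      2 * D ^ 2 + 2 * (M / m) ^ 2 * (h (f ω.1) - r ω) ^ 2 := fun ω => by
    have h1 := sq_le_sq.2 (abs_shiftCorrection_rescale_sub_le hwpos hρ hρs (hh' ω))
    have h2 := abs_shiftCorrection_sub_le hwpos (hh' ω) (hr01 ω)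
    have h3 := pow_le_pow_left₀ (abs_nonneg _) h2 2
    rw [sq_abs, mul_pow, sq_abs] at h3
    have h4 := add_sq_le (a := shiftCorrection (fun k => ρ k * trueWeight P Q k) (h (f ω.1)) -
      shiftCorrection (trueWeight P Q) (h (f ω.1)))
      (b := shiftCorrection (trueWeight P Q) (h (f ω.1)) - shiftCorrection (trueWeight P Q) (r ω))
    rw [sub_add_sub_cancel] at h4
    change _ ≤ (M / m) ^ 2 * _ at h3
    linarith
  have hQP : ∫ ω, (h (f ω.1) - r ω) ^ 2 ∂Q ≤ M * ∫ ω, (h (f ω.1) - r ω) ^ 2 ∂P := by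
    have := setIntegral_target hPQ (fun ω => (h (f ω.1) - r ω) ^ 2) MeasurableSet.univ
    rw [setIntegral_univ, setIntegral_univ] at this
    rw [this, ← integral_const_mul]
    refine integral_mono_of_nonneg (ae_of_all _ fun ω => mul_nonneg (hwpos _).le (sq_nonneg _))
      (hPi.const_mul _) (ae_of_all _ fun ω => ?_)
    exact mul_le_mul_of_nonneg_right (trueWeight_le_maxWeight _) (sq_nonneg _)
  have hRP : ∫ ω, (h (f ω.1) - r ω) ^ 2 ∂P = risk P f h := by
    refine integral_congr_ae ?_
    filter_upwards [clippedCondLabel_ae_eq (P := P) hf] with ω hω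
    simp only [r, hω]
  calc risk Q f (shiftCorrection (fun k => ρ k * trueWeight P Q k) ∘ h)
      = ∫ ω, (shiftCorrection (fun k => ρ k * trueWeight P Q k) (h (f ω.1)) -
          shiftCorrection (trueWeight P Q) (r ω)) ^ 2 ∂Q := by
        refine integral_congr_ae ?_
        filter_upwards [condLabel_target_ae_eq hf hPQ] with ω hω
        rw [hω]; rfl
    _ ≤ ∫ ω, (2 * D ^ 2 + 2 * (M / m) ^ 2 * (h (f ω.1) - r ω) ^ 2) ∂Q :=
        integral_mono_of_nonneg (ae_of_all _ fun ω => sq_nonneg _)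
          ((integrable_const _).add (hQi.const_mul _)) (ae_of_all _ hpt)
    _ = 2 * D ^ 2 + 2 * (M / m) ^ 2 * ∫ ω, (h (f ω.1) - r ω) ^ 2 ∂Q := by
        rw [integral_add (integrable_const _) (hQi.const_mul _), integral_const, integral_const_mul]
        simp
    _ ≤ 2 * D ^ 2 + 2 * (M / m) ^ 2 * (M * risk P f h) := by
        rw [← hRP]
        gcongr
    _ = _ := by
        field_simp

lemma risk_compositeEstimator_le (hf : Measurable f) (hf01 : ∀ x, f x ∈ Icc (0 : ℝ) 1)
    (hPQ : LabelShift P Q) {nP nQ B : ℕ} (hnQ : 0 < nQ)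
    (DP : Fin nP → 𝒳 × Fin 2) (DQ : Fin nQ → 𝒳 × Fin 2) (hDP : ∀ k, 0 < empClassProb DP k) :
    risk Q f (compositeEstimator f DP DQ B) ≤
      2 * (((weightRatio P Q DP DQ 0 - weightRatio P Q DP DQ 1) /
              (weightRatio P Q DP DQ 0 + weightRatio P Q DP DQ 1)) ^ 2 +
        maxWeight P Q ^ 3 / minWeight P Q ^ 2 * risk P f (umbRecalibration f DP B)) := by
  have hwpos := trueWeight_pos hPQ
  have hρ : ∀ k, 0 ≤ weightRatio P Q DP DQ k := fun k =>
    div_nonneg (div_nonneg (empClassProb_nonneg _ _) (hDP k).le) (hwpos k).le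
  have hρs : 0 < weightRatio P Q DP DQ 0 + weightRatio P Q DP DQ 1 := by
    have hpos : ∀ k, 0 < empClassProb DQ k → 0 < weightRatio P Q DP DQ k := fun k hk =>
      div_pos (div_pos hk (hDP k)) (hwpos k)
    rcases (empClassProb_nonneg DQ 0).lt_or_eq with h | h
    · exact add_pos_of_pos_of_nonneg (hpos 0 h) (hρ 1)
    · refine add_pos_of_nonneg_of_pos (hρ 0) (hpos 1 ?_)
      have := empClassProb_add hnQ DQ
      linarith
  have hcomp : compositeEstimator f DP DQ B =
      shiftCorrection (fun k => weightRatio P Q DP DQ k * trueWeight P Q k) ∘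
        umbRecalibration f DP B := by
    unfold compositeEstimator
    congr 2
    funext k
    rw [weightRatio, div_mul_cancel₀ _ (hwpos k).ne']
  rw [hcomp]
  exact risk_comp_le hf hf01 hPQ hρ hρs (measurable_umbRecalibration DP B)
    fun z _ => umbRecalibration_mem_Icc hf01 DP B z

end Deterministic

end Population

/-! ### Quantiles of the score and errors on a bin -/

section ScoreCdf

variable {𝒳 : Type*} [MeasurableSpace 𝒳] {P : Measure (𝒳 × Fin 2)} [IsProbabilityMeasure P]
  {f : 𝒳 → ℝ}

lemma monotone_scoreCdf : Monotone (scoreCdf P f) := fun _ _ h =>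
  measureReal_mono fun _ hω => le_trans hω h

lemma scoreCdf_mem_Icc (s : ℝ) : scoreCdf P f s ∈ Icc (0 : ℝ) 1 :=
  ⟨measureReal_nonneg, measureReal_le_one⟩

lemma continuous_scoreCdf (hf : Measurable f)
    (hna : ∀ c : ℝ, P {ω : 𝒳 × Fin 2 | f ω.1 = c} = 0) : Continuous (scoreCdf P f) := by
  have hzm := measurable_score (𝒳 := 𝒳) hf
  have hset : ∀ s, MeasurableSet {ω : 𝒳 × Fin 2 | f ω.1 ≤ s} := fun s =>
    measurableSet_le hzm measurable_const
  have h : scoreCdf P f = fun s =>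
      ∫ ω, {ω : 𝒳 × Fin 2 | f ω.1 ≤ s}.indicator (1 : 𝒳 × Fin 2 → ℝ) ω ∂P := by
    funext s
    rw [integral_indicator_one (hset s)]
    rfl
  rw [h]
  refine continuous_iff_continuousAt.2 fun s₀ => ?_
  refine continuousAt_of_dominated (bound := fun _ => 1)
    (Filter.Eventually.of_forall fun s =>
      (measurable_one.indicator (hset s)).aestronglyMeasurable)
    (Filter.Eventually.of_forall fun s => ae_of_all _ fun ω => ?_) (integrable_const _) ?_
  · by_cases hω : f ω.1 ≤ s <;> simp [indicator, hω]
  · have h0 : ∀ᵐ ω ∂P, f ω.1 ≠ s₀ := ae_iff.2 (by simpa using hna s₀)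
    filter_upwards [h0] with ω hω
    rcases lt_or_gt_of_ne hω with hlt | hgt
    · refine (continuousAt_const (y := (1 : ℝ))).congr ?_
      filter_upwards [Ioi_mem_nhds hlt] with s hs
      have : f ω.1 ≤ s := le_of_lt hs
      simp [indicator, this]
    · refine (continuousAt_const (y := (0 : ℝ))).congr ?_
      filter_upwards [Iio_mem_nhds hgt] with s hs
      have : ¬ f ω.1 ≤ s := not_le.2 hs
      simp [indicator, this]

lemma exists_quantiles (hf : Measurable f) (hf01 : ∀ x, f x ∈ Icc (0 : ℝ) 1)
    (hna : ∀ c : ℝ, P {ω : 𝒳 × Fin 2 | f ω.1 = c} = 0) {B : ℕ} (hB : 0 < B) :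
    ∃ q : ℕ → ℝ, ∀ l ≤ B, scoreCdf P f (q l) = l / B := by
  have hB' : (0 : ℝ) < B := by exact_mod_cast hB
  have h0 : scoreCdf P f 0 = 0 := by
    rw [scoreCdf, measureReal_def, measure_mono_null (fun ω hω => ?_) (hna 0), ENNReal.toReal_zero]
    exact le_antisymm hω (hf01 _).1
  have h1 : scoreCdf P f 1 = 1 := by
    have : {ω : 𝒳 × Fin 2 | f ω.1 ≤ 1} = univ := by ext ω; simp [(hf01 ω.1).2]
    rw [scoreCdf, this, probReal_univ]
  have hiv := intermediate_value_Icc (zero_le_one (α := ℝ))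
    (continuous_scoreCdf hf hna).continuousOn
  rw [h0, h1] at hiv
  have hex : ∀ l : ℕ, ∃ s, l ≤ B → scoreCdf P f s = l / B := fun l => by
    by_cases hl : l ≤ B
    · obtain ⟨s, -, hs⟩ := hiv (show (l : ℝ) / B ∈ Icc (0 : ℝ) 1 from
        ⟨by positivity, div_le_one_of_le₀ (by exact_mod_cast hl) hB'.le⟩)
      exact ⟨s, fun _ => hs⟩
    · exact ⟨0, fun h => absurd h hl⟩
  choose q hq using hex
  exact ⟨q, hq⟩

lemma measureReal_Ioc_score (hf : Measurable f) {a b : ℝ} (hab : a ≤ b) :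
    P.real {ω : 𝒳 × Fin 2 | f ω.1 ∈ Ioc a b} = scoreCdf P f b - scoreCdf P f a := by
  have h : {ω : 𝒳 × Fin 2 | f ω.1 ∈ Ioc a b} =
      {ω : 𝒳 × Fin 2 | f ω.1 ≤ b} \ {ω : 𝒳 × Fin 2 | f ω.1 ≤ a} := by
    ext ω; simp [and_comm]
  have hsub : {ω : 𝒳 × Fin 2 | f ω.1 ≤ a} ⊆ {ω : 𝒳 × Fin 2 | f ω.1 ≤ b} :=
    fun ω hω => le_trans (show f ω.1 ≤ a from hω) hab
  rw [h, measureReal_sdiff hsub (measurableSet_le (measurable_score hf) measurable_const)]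
  rfl

lemma cntLe_sub_eq {n : ℕ} (v : Fin n → ℝ) {a b : ℝ} (hab : a ≤ b) :
    (cntLe v b : ℝ) - cntLe v a = ((Finset.univ.filter fun k => v k ∈ Ioc a b).card : ℝ) := by
  have hsub : (Finset.univ.filter fun k => v k ≤ a) ⊆ Finset.univ.filter fun k => v k ≤ b := by
    intro k hk
    simp only [Finset.mem_filter, Finset.mem_univ, true_and] at hk ⊢
    exact hk.trans hab
  have h : (Finset.univ.filter fun k => v k ∈ Ioc a b) =
      (Finset.univ.filter fun k => v k ≤ b) \ Finset.univ.filter fun k => v k ≤ a := by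
    ext k; simp [and_comm]
  rw [h, Finset.card_sdiff_of_subset hsub, Nat.cast_sub (Finset.card_le_card hsub)]
  rfl

/-- Each cell of a grid of `B` quantiles contains, with high probability, at least half of its
expected number of scores. -/
lemma pi_quantile_cell_le (hf : Measurable f) {n B : ℕ} (hB : 0 < B) {q : ℕ → ℝ}
    (hq : ∀ l ≤ B, scoreCdf P f (q l) = l / B) {l : ℕ} (hl : l < B) :
    (Measure.pi fun _ : Fin n => P)
      {x | (cntLe (fun k => f (x k).1) (q (l + 1)) : ℝ) - cntLe (fun k => f (x k).1) (q l) <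
        (n : ℝ) / (2 * B)} ≤ ENNReal.ofReal (2 * Real.exp (-(n / (16 * B)))) := by
  classical
  have hB' : (0 : ℝ) < B := by exact_mod_cast hB
  have hqq : q l ≤ q (l + 1) := by
    refine le_of_lt (monotone_scoreCdf (P := P) (f := f) |>.reflect_lt ?_)
    rw [hq l hl.le, hq (l + 1) hl]
    gcongr
    linarith
  have hA : MeasurableSet {ω : 𝒳 × Fin 2 | f ω.1 ∈ Ioc (q l) (q (l + 1))} :=
    measurable_score hf measurableSet_Ioc
  have hPA : P.real {ω : 𝒳 × Fin 2 | f ω.1 ∈ Ioc (q l) (q (l + 1))} = 1 / B := by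
    rw [measureReal_Ioc_score hf hqq, hq l hl.le, hq (l + 1) hl]
    push_cast; ring
  have key := measureReal_pi_abs_card_sub_ge_le (κ := Fin n) P hA (η := 1 / 2) (by norm_num)
    (by norm_num)
  rw [hPA, Fintype.card_fin] at key
  rw [← ENNReal.ofReal_toReal (measure_ne_top _ _)]
  refine ENNReal.ofReal_le_ofReal ((measureReal_mono ?_).trans (key.trans (le_of_eq ?_)))
  · intro x hx
    simp only [mem_ofPred_eq] at hx ⊢
    rw [cntLe_sub_eq _ hqq] at hx
    refine le_trans ?_ (neg_le_abs _)
    have h1 : (n : ℝ) / (2 * B) = 1 / 2 * (n * (1 / B)) := by ring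
    have h2 : (n : ℝ) * (1 / B) = 2 * (1 / 2 * (n * (1 / B))) := by ring
    rw [h1] at hx
    linarith
  · congr 2
    ring

end ScoreCdf

section BinError

variable {E : Type*} [MeasurableSpace E]

/-- The squared distance of a constant to a function on an event: the calibration error of the
constant plus the variance of the function, the latter bounded through its range. -/
lemma setIntegral_sq_sub_le {P : Measure E} [IsProbabilityMeasure P] {A : Set E}
    (hA : MeasurableSet A) {φ : E → ℝ} (hφ : Measurable φ) (hφ01 : ∀ x, φ x ∈ Icc (0 : ℝ) 1)
    {a c r ε : ℝ} (hr : ∀ x ∈ A, |φ x - c| ≤ r) (ha : |a - condMean P A φ| ≤ ε) :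
    ∫ x in A, (a - φ x) ^ 2 ∂P ≤ P.real A * (ε ^ 2 + r ^ 2) := by
  set μ := condMean P A φ with hμ
  have hφi : Integrable φ P := integrable_of_mem_Icc hφ hφ01
  have hint : ∫ x in A, φ x ∂P = P.real A * μ := by
    by_cases h0 : P.real A = 0
    · have : P.restrict A = 0 := Measure.restrict_eq_zero.2 ((measureReal_eq_zero_iff).1 h0)
      simp [this, h0]
    · rw [hμ, condMean, mul_div_cancel₀ _ h0]
  have hpt : ∀ x ∈ A, (a - φ x) ^ 2 ≤ (ε ^ 2 + r ^ 2) - 2 * (a - c) * (φ x - μ) := fun x hx => by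
    have h1 : (φ x - c) ^ 2 ≤ r ^ 2 := by
      rw [← sq_abs]; exact pow_le_pow_left₀ (abs_nonneg _) (hr x hx) 2
    have h2 : (a - μ) ^ 2 ≤ ε ^ 2 := by
      rw [← sq_abs]; exact pow_le_pow_left₀ (abs_nonneg _) ha 2
    nlinarith [sq_nonneg (μ - c)]
  have hi : IntegrableOn (fun x => 2 * (a - c) * (φ x - μ)) A P :=
    ((hφi.sub (integrable_const _)).const_mul _).integrableOn
  have hi' : IntegrableOn (fun _ : E => ε ^ 2 + r ^ 2) A P := (integrable_const _).integrableOn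
  calc ∫ x in A, (a - φ x) ^ 2 ∂P
      ≤ ∫ x in A, ((ε ^ 2 + r ^ 2) - 2 * (a - c) * (φ x - μ)) ∂P := by
        refine integral_mono_of_nonneg (ae_of_all _ fun x => sq_nonneg _) (hi'.sub hi) ?_
        filter_upwards [ae_restrict_mem hA] with x hx using hpt x hx
    _ = P.real A * (ε ^ 2 + r ^ 2) := by
        rw [integral_sub hi' hi, integral_const_mul,
          integral_sub hφi.integrableOn (integrable_const _), hint]
        simp

lemma condMean_mem_Icc {P : Measure E} [IsProbabilityMeasure P] (A : Set E) {g : E → ℝ}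
    (hg : Measurable g) (hg01 : ∀ x, g x ∈ Icc (0 : ℝ) 1) : condMean P A g ∈ Icc (0 : ℝ) 1 := by
  have h0 : 0 ≤ ∫ x in A, g x ∂P := integral_nonneg fun x => (hg01 x).1
  have h1 : ∫ x in A, g x ∂P ≤ P.real A := by
    have := integral_mono (μ := P.restrict A) (integrable_of_mem_Icc hg hg01)
      (integrable_const (1 : ℝ)) fun x => (hg01 x).2
    simpa using this
  exact ⟨div_nonneg h0 measureReal_nonneg, div_le_one_of_le₀ h1 measureReal_nonneg⟩

/-- The empirical label mean of a bin is close to `μ` if the labels strictly between the end points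
deviate from `μ` by less than `t` on average; a label at the right end point costs at most one more
unit in the sum. -/
lemma abs_binMean_sub_le {n : ℕ} {v y : Fin n → ℝ} (hv : Function.Injective v)
    (hy : ∀ k, y k ∈ Icc (0 : ℝ) 1) {I : Set ℝ} {a b : ℝ} {o' : Option (Fin n)}
    (hI : ∀ k, v k ∈ I ↔ v k ∈ Ioo a b ∨ (a < v k ∧ ∃ j, o' = some j ∧ v k = v j))
    (hb : ∀ j, o' = some j → b = v j) {m : ℕ} (hm : 2 ≤ m)
    (hcard : m - 1 ≤ (Finset.univ.filter fun k => v k ∈ Ioo a b).card)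
    {μ t : ℝ} (hμ : μ ∈ Icc (0 : ℝ) 1) (ht : 0 ≤ t)
    (hdev : |∑ k with v k ∈ Ioo a b, (y k - μ)| <
      t * (Finset.univ.filter fun k => v k ∈ Ioo a b).card) :
    |binMean v y I - μ| ≤ t + 1 / m := by
  classical
  set J := Finset.univ.filter fun k => v k ∈ Ioo a b with hJ
  have hM : (1 : ℝ) ≤ J.card := by
    have : 1 ≤ J.card := by omega
    exact_mod_cast this
  have hm0 : (0 : ℝ) < m := by
    have : 0 < m := by omega
    exact_mod_cast this
  have hmM : (m : ℝ) ≤ J.card + 1 := by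
    have : m ≤ J.card + 1 := by omega
    exact_mod_cast this
  have hbin : binMean v y I = (∑ k with v k ∈ I, y k) /
      ((Finset.univ.filter fun k => v k ∈ I).card : ℝ) := by
    unfold binMean
    simp [indicator_apply, Finset.sum_ite]
  rw [hbin]
  rw [Finset.sum_sub_distrib, Finset.sum_const, nsmul_eq_mul] at hdev
  by_cases hex : ∃ j, o' = some j
  · obtain ⟨j, hj⟩ := hex
    have hbj := hb j hj
    have haj : a < v j := by
      obtain ⟨k, hk⟩ := Finset.card_pos.1 (show 0 < J.card by omega)
      have := (Finset.mem_filter.1 hk).2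
      rw [← hbj]
      exact this.1.trans this.2
    have hjJ : j ∉ J := by
      rw [hJ, Finset.mem_filter, hbj]
      rintro ⟨-, h⟩
      exact lt_irrefl _ h.2
    have hfil : (Finset.univ.filter fun k => v k ∈ I) = insert j J := by
      ext k
      rw [Finset.mem_filter, hI k, Finset.mem_insert, hJ, Finset.mem_filter]
      simp only [Finset.mem_univ, true_and]
      constructor
      · rintro (h | ⟨-, i, hi, hki⟩)
        · exact Or.inr h
        · rw [hj, Option.some.injEq] at hi
          exact Or.inl (hv (hki.trans (by rw [hi])))
      · rintro (rfl | h)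
        · exact Or.inr ⟨haj, k, hj, rfl⟩
        · exact Or.inl h
    rw [hfil, Finset.sum_insert hjJ, Finset.card_insert_of_notMem hjJ]
    push_cast
    have hM1 : (0 : ℝ) < J.card + 1 := by linarith
    have hyj : |y j - μ| ≤ 1 := by
      rw [abs_le]; constructor <;> linarith [(hy j).1, (hy j).2, hμ.1, hμ.2]
    have heq : (y j + ∑ k ∈ J, y k) / ((J.card : ℝ) + 1) - μ =
        ((∑ k ∈ J, y k - J.card * μ) + (y j - μ)) / (J.card + 1) := by
      field_simp
      ring
    rw [heq, abs_div, abs_of_pos hM1, div_le_iff₀ hM1]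
    have h1 : 1 ≤ 1 / (m : ℝ) * (J.card + 1) := by
      rw [one_div_mul_eq_div, one_le_div hm0]; exact hmM
    calc _ ≤ |∑ k ∈ J, y k - J.card * μ| + |y j - μ| := abs_add_le _ _
      _ ≤ t * J.card + 1 := add_le_add hdev.le hyj
      _ ≤ _ := by rw [add_mul, mul_add]; linarith
  · have hfil : (Finset.univ.filter fun k => v k ∈ I) = J := by
      ext k
      rw [Finset.mem_filter, hI k, hJ, Finset.mem_filter]
      simp only [Finset.mem_univ, true_and, or_iff_left_iff_imp]
      rintro ⟨-, j, hj, -⟩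
      exact absurd ⟨j, hj⟩ hex
    rw [hfil]
    have hM0 : (0 : ℝ) < J.card := by linarith
    have heq : (∑ k ∈ J, y k) / (J.card : ℝ) - μ = (∑ k ∈ J, y k - J.card * μ) / J.card := by
      field_simp
    have h1 : 0 < 1 / (m : ℝ) := by positivity
    have h2 : |(∑ k ∈ J, y k - J.card * μ) / J.card| ≤ t := by
      rw [abs_div, abs_of_pos hM0, div_le_iff₀ hM0]
      exact hdev.le
    rw [heq]
    linarith

end BinError

/-! ### Risk of uniform-mass binning under the source -/

section SourceRisk

variable {𝒳 : Type*} [MeasurableSpace 𝒳] {P : Measure (𝒳 × Fin 2)} [IsProbabilityMeasure P]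
  {f : 𝒳 → ℝ} {h : ℝ → ℝ} {K : ℝ}

/-- On an event generated by the score, the label and the optimal recalibration function have the
same conditional mean. -/
lemma condMean_label_eq (hf : Measurable f) (hopt : IsOptimalRecalibration P f h) {I : Set ℝ}
    (hI : MeasurableSet I) :
    condMean P ((fun ω : 𝒳 × Fin 2 => f ω.1) ⁻¹' I) (fun ω => labelValue ω.2) =
      condMean P ((fun ω : 𝒳 × Fin 2 => f ω.1) ⁻¹' I) (fun ω => h (f ω.1)) := by
  have hi : Integrable (fun ω : 𝒳 × Fin 2 => labelValue ω.2) P :=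
    integrable_of_mem_Icc measurable_labelValue fun ω => labelValue_mem_Icc _
  have hle := (measurable_score (𝒳 := 𝒳) hf).comap_le
  unfold condMean
  congr 1
  rw [← setIntegral_condExp hle hi ⟨I, hI, rfl⟩]
  refine setIntegral_congr_ae (measurable_score hf hI) ?_
  filter_upwards [hopt.ae_eq] with ω hω _
  rw [hω]; rfl

/-- The risk of uniform-mass binning is at most `ε² + (K r / 2)²` if all bin means are calibrated
up to `ε` and all bins have mass at most `r`: a function with range of length `K r` on a bin
deviates from the centre of its range by at most `K r / 2`. -/
lemma risk_umbRecalibration_le (hf : Measurable f) (hf01 : ∀ x, f x ∈ Icc (0 : ℝ) 1)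
    (hreg : RegularScore P f h K) (hK : 0 ≤ K) {n B : ℕ} (hB : 0 < B) {D : Fin n → 𝒳 × Fin 2}
    {ε r : ℝ}
    (hcal : ∀ b < B, |binMean (fun i => f (D i).1) (fun i => labelValue (D i).2)
        (umbBin (fun i => f (D i).1) B b) -
      condMean P ((fun ω : 𝒳 × Fin 2 => f ω.1) ⁻¹' umbBin (fun i => f (D i).1) B b)
        (fun ω => labelValue ω.2)| ≤ ε)
    (hmass : ∀ b < B, scoreCdf P f (umbEdge (fun i => f (D i).1) B (b + 1)) -
      scoreCdf P f (umbEdge (fun i => f (D i).1) B b) ≤ r) :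
    risk P f (umbRecalibration f D B) ≤ ε ^ 2 + (K * r / 2) ^ 2 := by
  set v : Fin n → ℝ := fun i => f (D i).1 with hv
  have hv01 : ∀ k, v k ∈ Icc (0 : ℝ) 1 := fun k => hf01 _
  set a : ℕ → ℝ := fun b => binMean v (fun i => labelValue (D i).2) (umbBin v B b) with ha
  let A : ℕ → Set (𝒳 × Fin 2) := fun b => (fun ω : 𝒳 × Fin 2 => f ω.1) ⁻¹' umbBin v B b
  have hA : ∀ b, MeasurableSet (A b) := fun b => measurable_score hf (measurableSet_umbBin v B b)
  have hdisj : Set.Pairwise (↑(Finset.range B)) (Function.onFun Disjoint A) :=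
    fun b _ c _ hbc => Set.disjoint_left.2 fun ω hb hc => hbc (umbBin_unique hv01 hb hc)
  have hcover : ⋃ b ∈ Finset.range B, A b = univ := by
    refine eq_univ_of_forall fun ω => ?_
    obtain ⟨b, hb, hω⟩ := exists_mem_umbBin v hB (hf01 ω.1)
    exact mem_iUnion₂.2 ⟨b, Finset.mem_range.2 hb, hω⟩
  have hhm : Measurable fun ω : 𝒳 × Fin 2 => h (f ω.1) :=
    hreg.optimal.measurable.comp (measurable_score hf)
  have hh01 : ∀ ω : 𝒳 × Fin 2, h (f ω.1) ∈ Icc (0 : ℝ) 1 := fun ω =>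
    hreg.optimal.mapsTo (hf01 _)
  have hum : Measurable fun ω : 𝒳 × Fin 2 => umbRecalibration f D B (f ω.1) :=
    (measurable_umbRecalibration D B).comp (measurable_score hf)
  have hsqi : Integrable (fun ω : 𝒳 × Fin 2 => (umbRecalibration f D B (f ω.1) - h (f ω.1)) ^ 2)
      P := by
    refine integrable_of_mem_Icc (a := 0) (b := 1) ((hum.sub hhm).pow_const 2) fun ω =>
      ⟨sq_nonneg _, ?_⟩
    have h1 := umbRecalibration_mem_Icc hf01 D B (f ω.1)
    have h2 := hh01 ω
    rw [sq_le_one_iff_abs_le_one, abs_le]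
    constructor <;> linarith [h1.1, h1.2, h2.1, h2.2]
  have hbin : ∀ b ∈ Finset.range B,
      ∫ ω in A b, (umbRecalibration f D B (f ω.1) - h (f ω.1)) ^ 2 ∂P ≤
        P.real (A b) * (ε ^ 2 + (K * r / 2) ^ 2) := by
    intro b hb
    rw [Finset.mem_range] at hb
    have h1 : ∫ ω in A b, (umbRecalibration f D B (f ω.1) - h (f ω.1)) ^ 2 ∂P =
        ∫ ω in A b, (a b - h (f ω.1)) ^ 2 ∂P := by
      refine setIntegral_congr_fun (hA b) fun ω hω => ?_
      simp only [ha, hv]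
      rw [umbRecalibration_eq_of_mem hf01 hb hω]
    rw [h1]
    have hu := umbEdge_mem_Icc hv01 B b
    have hw := umbEdge_mem_Icc hv01 B (b + 1)
    have huw := umbEdge_mono hv01 B (Nat.le_succ b)
    -- the centre of the range of `h` on the bin
    refine setIntegral_sq_sub_le (hA b) hhm hh01
      (c := (h (umbEdge v B b) + h (umbEdge v B (b + 1))) / 2) (fun ω hω => ?_) ?_
    · have hmem := umbBin_subset v B b hω
      have m1 := hreg.monotone hu (hf01 ω.1) hmem.1
      have m2 := hreg.monotone (hf01 ω.1) hw hmem.2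
      have hs := (le_abs_self _).trans (hreg.smooth _ hu _ hw huw)
      have hr := mul_le_mul_of_nonneg_left (hmass b hb) hK
      rw [abs_le]
      constructor <;> linarith
    · rw [← condMean_label_eq hf hreg.optimal (measurableSet_umbBin v B b)]
      exact hcal b hb
  calc risk P f (umbRecalibration f D B)
      = ∫ ω, (umbRecalibration f D B (f ω.1) - h (f ω.1)) ^ 2 ∂P := by
        refine integral_congr_ae ?_
        filter_upwards [hreg.optimal.ae_eq] with ω hω
        rw [hω]
    _ = ∑ b ∈ Finset.range B,
          ∫ ω in A b, (umbRecalibration f D B (f ω.1) - h (f ω.1)) ^ 2 ∂P := by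
        rw [← setIntegral_univ, ← hcover]
        exact integral_biUnion_finset _ (fun b _ => hA b) hdisj fun b _ => hsqi.integrableOn
    _ ≤ ∑ b ∈ Finset.range B, P.real (A b) * (ε ^ 2 + (K * r / 2) ^ 2) := Finset.sum_le_sum hbin
    _ = ε ^ 2 + (K * r / 2) ^ 2 := by
        rw [← Finset.sum_mul, ← measureReal_biUnion_finset hdisj fun b _ => hA b, hcover,
          probReal_univ, one_mul]

/-- The calibration error of a bin on a sample without ties that avoids the deviation event of the
bin. -/
lemma abs_binMean_sub_condMean_le (hf01 : ∀ x, f x ∈ Icc (0 : ℝ) 1)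
    (hna : ∀ c : ℝ, P {ω : 𝒳 × Fin 2 | f ω.1 = c} = 0) {n B b : ℕ} (hb : b < B)
    (hBn : 2 ≤ n / B) {D : Fin n → 𝒳 × Fin 2} (hinj : Function.Injective fun i => f (D i).1)
    (hpos : ∀ i, f (D i).1 ∈ Ioc (0 : ℝ) 1) {t : ℝ} (ht : 0 ≤ t)
    (hdev : ¬ ∃ o o', D ∈ rankEvent (fun ω : 𝒳 × Fin 2 => f ω.1) (n * b / B)
        (if b + 1 = B then n else n * (b + 1) / B - 1) o o' ∩
      deviationEvent P (fun ω : 𝒳 × Fin 2 => f ω.1) (fun ω => labelValue ω.2) t o o') :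
    |binMean (fun i => f (D i).1) (fun i => labelValue (D i).2)
        (umbBin (fun i => f (D i).1) B b) -
      condMean P ((fun ω : 𝒳 × Fin 2 => f ω.1) ⁻¹' umbBin (fun i => f (D i).1) B b)
        (fun ω => labelValue ω.2)| ≤ t + 1 / (n / B : ℕ) := by
  have hB : 0 < B := by omega
  have hBn' : B ≤ n := by
    have := (Nat.le_div_iff_mul_le hB).1 (show 1 ≤ n / B by omega)
    omega
  set v : Fin n → ℝ := fun i => f (D i).1 with hv
  obtain ⟨o, o', ho, ho', hbin⟩ := exists_ends_umbBin hinj hpos hBn' hb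
  have hIcc : ∀ k, v k ∈ Icc (0 : ℝ) 1 := fun k => hf01 _
  have hm : n / B - 1 ≤ (if b + 1 = B then n else n * (b + 1) / B - 1) - n * b / B := by
    have h1 := le_mul_succ_div_sub (B := B) n b
    split_ifs with hlast
    · rw [hlast, Nat.mul_div_cancel _ hB] at h1
      omega
    · omega
  have hnd : D ∉ deviationEvent P (fun ω : 𝒳 × Fin 2 => f ω.1) (fun ω => labelValue ω.2) t o o' :=
    fun hD => hdev ⟨o, o', ⟨ho, ho'⟩, hD⟩
  simp only [deviationEvent, mem_ofPred_eq, not_le] at hnd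
  -- the interval and the bin differ by a null set
  have hae : ((fun ω : 𝒳 × Fin 2 => f ω.1) ⁻¹' Ioo (leftEnd v o) (rightEnd v o') :
      Set (𝒳 × Fin 2)) =ᵐ[P] (fun ω : 𝒳 × Fin 2 => f ω.1) ⁻¹' umbBin v B b := by
    have h0 : ∀ᵐ ω ∂P, ∀ j, f ω.1 ≠ v j := ae_all_iff.2 fun j =>
      ae_iff.2 (by simpa using hna (v j))
    filter_upwards [h0] with ω hω
    refine propext ?_
    change f ω.1 ∈ Ioo (leftEnd v o) (rightEnd v o') ↔ f ω.1 ∈ umbBin v B b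
    rw [hbin _ (hf01 _)]
    constructor
    · exact Or.inl
    · rintro (h | ⟨-, j, -, hj⟩)
      · exact h
      · exact absurd hj (hω j)
  have hcm : condMean P ((fun ω : 𝒳 × Fin 2 => f ω.1) ⁻¹' Ioo (leftEnd v o) (rightEnd v o'))
      (fun ω => labelValue ω.2) = condMean P ((fun ω : 𝒳 × Fin 2 => f ω.1) ⁻¹' umbBin v B b)
      (fun ω => labelValue ω.2) := by
    unfold condMean
    rw [setIntegral_congr_set hae, measureReal_congr hae]
  refine abs_binMean_sub_le hinj (fun k => labelValue_mem_Icc _)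
    (a := leftEnd v o) (b := rightEnd v o') (o' := o') (fun k => hbin _ (hIcc k)) ?_ hBn ?_
    (condMean_mem_Icc _ measurable_labelValue fun ω => labelValue_mem_Icc _) ht ?_
  · rintro j rfl; rfl
  · refine hm.trans ?_
    rw [← ho, ← ho', cntLt, cntLe, tsub_le_iff_left]
    refine (Finset.card_le_card ?_).trans (Finset.card_union_le _ _)
    intro k hk
    simp only [Finset.mem_filter, Finset.mem_univ, true_and, Finset.mem_union] at hk ⊢
    rcases le_or_gt (v k) (leftEnd v o) with hle | hgt
    · exact Or.inl hle
    · exact Or.inr ⟨hgt, hk⟩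
  · rw [← hcm]
    exact hnd

/-- With probability at least `1 - δ / 2`, the risk of uniform-mass binning under the source is at
most the sum of the squared calibration error and the squared sharpness error. -/
lemma pi_risk_umbRecalibration_gt_le (hf : Measurable f) (hf01 : ∀ x, f x ∈ Icc (0 : ℝ) 1)
    (hreg : RegularScore P f h K) (hK : 0 ≤ K) {δ : ℝ} (hδ : δ ∈ Ioo (0 : ℝ) 1) {n B : ℕ}
    (hB : 0 < B) (hn : 32 * (B * Real.log (4 * B / δ)) ≤ n) :
    (Measure.pi fun _ : Fin n => P) {x | ¬ risk P f (umbRecalibration f x B) ≤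
        (Real.sqrt (1 / (2 * (((n / B : ℕ) : ℝ) - 1)) * Real.log (8 * B / δ)) +
          1 / ((n / B : ℕ) : ℝ)) ^ 2 + 8 * K ^ 2 / (B : ℝ) ^ 2} ≤ ENNReal.ofReal (δ / 2) := by
  set π := Measure.pi fun _ : Fin n => P
  have hB' : (1 : ℝ) ≤ B := by exact_mod_cast hB
  have hB0 : (0 : ℝ) < B := by linarith
  have hδ0 := hδ.1
  have hlog : 1 ≤ Real.log (4 * B / δ) := by
    rw [Real.le_log_iff_exp_le (by positivity), le_div_iff₀ hδ0]
    have := Real.exp_one_lt_d9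
    nlinarith [hδ.2, Real.exp_pos 1]
  have h32 : 32 * (B : ℝ) ≤ n := by nlinarith
  have hm2 : 2 ≤ n / B := by
    rw [Nat.le_div_iff_mul_le hB]
    have : 2 * (B : ℝ) ≤ n := by linarith
    exact_mod_cast this
  have hm2' : (2 : ℝ) ≤ ((n / B : ℕ) : ℝ) := by exact_mod_cast hm2
  set m : ℝ := ((n / B : ℕ) : ℝ) with hmdef
  set t : ℝ := Real.sqrt (1 / (2 * (m - 1)) * Real.log (8 * B / δ)) with ht
  have hlog8 : 0 ≤ Real.log (8 * B / δ) := by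
    refine Real.log_nonneg ?_
    rw [le_div_iff₀ hδ0]; linarith [hδ.2]
  have ht2 : 2 * (m - 1) * t ^ 2 = Real.log (8 * B / δ) := by
    have hm1 : 0 < m - 1 := by linarith
    rw [ht, Real.sq_sqrt (by positivity)]
    field_simp
  obtain ⟨q, hq⟩ := exists_quantiles hf hf01 hreg.no_atoms hB
  let R₂ : ℕ → ℕ := fun b => if b + 1 = B then n else n * (b + 1) / B - 1
  let G : ℕ → Set (Fin n → 𝒳 × Fin 2) := fun l =>
    {x | (cntLe (fun k => f (x k).1) (q (l + 1)) : ℝ) - cntLe (fun k => f (x k).1) (q l) <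
        (n : ℝ) / (2 * B)}
  let C : ℕ → Set (Fin n → 𝒳 × Fin 2) := fun b =>
    {x | ∃ o o', x ∈ rankEvent (fun ω : 𝒳 × Fin 2 => f ω.1) (n * b / B) (R₂ b) o o' ∩
      deviationEvent P (fun ω : 𝒳 × Fin 2 => f ω.1) (fun ω => labelValue ω.2) t o o'}
  let N : Set (Fin n → 𝒳 × Fin 2) :=
    {x | ¬ (Function.Injective (fun i => f (x i).1) ∧ ∀ i, f (x i).1 ∈ Ioc (0 : ℝ) 1)}
  have hN : π N = 0 := by
    refine ae_iff.1 ?_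
    have h1 := ae_injective_score (n := n) P (measurable_score hf) hreg.no_atoms
    have h2 : ∀ᵐ x ∂π, ∀ i, f (x i).1 ≠ 0 := by
      refine ae_all_iff.2 fun i => ae_iff.2 ?_
      simp only [ne_eq, not_not]
      exact Measure.pi_eval_preimage_null (fun _ : Fin n => P) (hreg.no_atoms 0)
    filter_upwards [h1, h2] with x hx1 hx2
    exact ⟨hx1, fun i => ⟨lt_of_le_of_ne (hf01 _).1 (hx2 i).symm, (hf01 _).2⟩⟩
  have hG : ∀ l ∈ Finset.range B, π (G l) ≤ ENNReal.ofReal (δ / (4 * B)) := fun l hl => by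
    refine (pi_quantile_cell_le hf hB hq (Finset.mem_range.1 hl)).trans
      (ENNReal.ofReal_le_ofReal ?_)
    have hx : 0 < δ / (4 * B) := by positivity
    have hx4 : δ / (4 * B) ≤ 1 / 2 := by
      rw [div_le_iff₀ (by positivity)]; linarith [hδ.2]
    have h1 : Real.exp (-(n / (16 * B))) ≤ (δ / (4 * B)) ^ 2 := by
      rw [← Real.exp_log (pow_pos hx 2), Real.exp_le_exp, Real.log_pow,
        show δ / (4 * B) = (4 * B / δ)⁻¹ by rw [inv_div], Real.log_inv]
      have : 2 * Real.log (4 * B / δ) ≤ n / (16 * B) := by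
        rw [le_div_iff₀ (by positivity)]; linarith
      push_cast
      linarith
    nlinarith
  have hC : ∀ b ∈ Finset.range B, π (C b) ≤ ENNReal.ofReal (δ / (4 * B)) := fun b hb => by
    rw [Finset.mem_range] at hb
    have hsucc := le_mul_succ_div_sub (B := B) n b
    have hr : n / B - 1 ≤ R₂ b - n * b / B := by
      simp only [R₂]
      split_ifs with hlast
      · rw [hlast, Nat.mul_div_cancel _ hB] at hsucc
        omega
      · omega
    refine (pi_exists_deviation_le P (measurable_score hf) (fun ω => hf01 _) hreg.no_atoms
      measurable_labelValue (fun ω => labelValue_mem_Icc _) (Real.sqrt_nonneg _)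
      (by omega)).trans (ENNReal.ofReal_le_ofReal ?_)
    have hr' : m - 1 ≤ ((R₂ b - n * b / B : ℕ) : ℝ) := by
      have : ((n / B - 1 : ℕ) : ℝ) ≤ ((R₂ b - n * b / B : ℕ) : ℝ) := by exact_mod_cast hr
      rwa [Nat.cast_sub (by omega), Nat.cast_one] at this
    have h1 : Real.exp (-2 * ((R₂ b - n * b / B : ℕ) : ℝ) * t ^ 2) ≤ δ / (8 * B) := by
      rw [← Real.exp_log (show 0 < δ / (8 * B) by positivity), Real.exp_le_exp,
        show δ / (8 * B) = (8 * B / δ)⁻¹ by rw [inv_div], Real.log_inv, ← ht2]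
      nlinarith [sq_nonneg t]
    have h2 : δ / (4 * B) = 2 * (δ / (8 * B)) := by field_simp; norm_num
    rw [h2]
    linarith
  have hsub : {x : Fin n → 𝒳 × Fin 2 | ¬ risk P f (umbRecalibration f x B) ≤
      (t + 1 / m) ^ 2 + 8 * K ^ 2 / (B : ℝ) ^ 2} ⊆
      N ∪ ((⋃ l ∈ Finset.range B, G l) ∪ ⋃ b ∈ Finset.range B, C b) := by
    intro x hx
    by_contra hcon
    simp only [mem_union, mem_iUnion, not_or, not_exists, exists_prop, not_and,
      Finset.mem_range] at hcon
    obtain ⟨hxN, hxG, hxC⟩ := hcon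
    obtain ⟨hinj, hpos⟩ := not_not.1 hxN
    refine hx ?_
    have hr := risk_umbRecalibration_le hf hf01 hreg hK hB (D := x) (ε := t + 1 / m) (r := 4 / B)
      (fun b hb => abs_binMean_sub_condMean_le hf01 hreg.no_atoms hb hm2 hinj hpos
        (Real.sqrt_nonneg _) (hxC b hb))
      (fun b hb => umbBin_mass_le hinj hpos hB (by linarith) hb monotone_scoreCdf
        scoreCdf_mem_Icc hq fun l hl => not_lt.1 (hxG l hl))
    refine hr.trans ?_
    have : (K * (4 / B) / 2) ^ 2 = 4 * K ^ 2 / (B : ℝ) ^ 2 := by field_simp; norm_num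
    rw [this]
    gcongr
    norm_num
  have hsum : ∀ S : ℕ → Set (Fin n → 𝒳 × Fin 2),
      (∀ b ∈ Finset.range B, π (S b) ≤ ENNReal.ofReal (δ / (4 * B))) →
      π (⋃ b ∈ Finset.range B, S b) ≤ ENNReal.ofReal (δ / 4) := fun S hS => by
    refine (measure_biUnion_finset_le _ _).trans ((Finset.sum_le_sum hS).trans (le_of_eq ?_))
    rw [Finset.sum_const, Finset.card_range, ← ENNReal.ofReal_nsmul, nsmul_eq_mul]
    congr 1
    field_simp
  refine (measure_mono hsub).trans ((measure_union_le _ _).trans ?_)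
  rw [hN, zero_add]
  refine (measure_union_le _ _).trans ((add_le_add (hsum G hG) (hsum C hC)).trans (le_of_eq ?_))
  rw [← ENNReal.ofReal_add (by positivity) (by positivity)]
  congr 1
  ring

end SourceRisk

/-! ### Estimated weights and sample sizes -/

section IID

variable {Ω E : Type*} [MeasurableSpace Ω] [MeasurableSpace E]

lemma IsIIDSample.map_eq_pi {μ : Measure Ω} {P : Measure E} {n : ℕ}
    {D : Fin n → Ω → E} (hD : IsIIDSample μ P D) :
    μ.map (fun ω i => D i ω) = Measure.pi fun _ : Fin n => P := by
  have hprob : IsProbabilityMeasure μ := hD.indep.isProbabilityMeasure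
  rw [(iIndepFun_iff_map_fun_eq_pi_map fun i => (hD.measurable i).aemeasurable).1 hD.indep]
  simp only [hD.law]

/-- The bound holds for arbitrary events, whether measurable or not. -/
lemma IsIIDSample.measure_le_pi {μ : Measure Ω} {P : Measure E} {n : ℕ}
    {D : Fin n → Ω → E} (hD : IsIIDSample μ P D) (S : Set (Fin n → E)) :
    μ {ω | (fun i => D i ω) ∈ S} ≤ (Measure.pi fun _ : Fin n => P) S := by
  rw [← hD.map_eq_pi]
  exact Measure.le_map_apply (measurable_pi_lambda _ hD.measurable).aemeasurable S

end IID

section Weights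

/-- The weight ratios are nearly equal if all class frequencies are accurate relative to the class
probabilities. -/
lemma abs_ratio_le {α β : Fin 2 → ℝ} {a b : ℝ} (ha : a ∈ Ico (0 : ℝ) 1) (hb : b ∈ Ico (0 : ℝ) 1)
    (hα : ∀ k, |α k - 1| ≤ a) (hβ : ∀ k, |β k - 1| ≤ b) :
    |(β 0 / α 0 - β 1 / α 1) / (β 0 / α 0 + β 1 / α 1)| ≤ a + b := by
  have hα' : ∀ k, 1 - a ≤ α k ∧ α k ≤ 1 + a := fun k => by
    have := abs_le.1 (hα k); constructor <;> linarith
  have hβ' : ∀ k, 1 - b ≤ β k ∧ β k ≤ 1 + b := fun k => by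
    have := abs_le.1 (hβ k); constructor <;> linarith
  have h1a : 0 < 1 - a := by linarith [ha.2]
  have h1b : 0 < 1 - b := by linarith [hb.2]
  have hα0 : ∀ k, 0 < α k := fun k => h1a.trans_le (hα' k).1
  have hβ0 : ∀ k, 0 < β k := fun k => h1b.trans_le (hβ' k).1
  have hx : ∀ i j, β i * α j - β j * α i ≤ (a + b) * (β i * α j + β j * α i) := fun i j => by
    have hup : β i * α j ≤ (1 + b) * (1 + a) :=
      mul_le_mul (hβ' i).2 (hα' j).2 (hα0 j).le (by linarith [hb.1])
    have hlo : (1 - b) * (1 - a) ≤ β j * α i :=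
      mul_le_mul (hβ' j).1 (hα' i).1 h1a.le (hβ0 j).le
    have hy : 0 ≤ β j * α i := (mul_pos (hβ0 j) (hα0 i)).le
    have hx : 0 ≤ β i * α j := (mul_pos (hβ0 i) (hα0 j)).le
    have hab : 0 ≤ a + b := add_nonneg ha.1 hb.1
    rcases le_total 1 (a + b) with hs | hs
    · nlinarith
    · have e1 := mul_le_mul_of_nonneg_right hup (sub_nonneg.2 hs)
      have e2 := mul_le_mul_of_nonneg_right hlo (show 0 ≤ 1 + (a + b) by linarith)
      have e3 : 0 ≤ a * b * (a + b) := mul_nonneg (mul_nonneg ha.1 hb.1) hab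
      nlinarith
  have hpos : 0 < β 0 * α 1 + β 1 * α 0 :=
    add_pos (mul_pos (hβ0 0) (hα0 1)) (mul_pos (hβ0 1) (hα0 0))
  have heq : (β 0 / α 0 - β 1 / α 1) / (β 0 / α 0 + β 1 / α 1) =
      (β 0 * α 1 - β 1 * α 0) / (β 0 * α 1 + β 1 * α 0) := by
    have h0 := (hα0 0).ne'
    have h1 := (hα0 1).ne'
    field_simp
  rw [heq, abs_div, abs_of_pos hpos, div_le_iff₀ hpos, abs_le]
  constructor
  · have := hx 1 0; linarith
  · exact hx 0 1

variable {𝒳 : Type*} [MeasurableSpace 𝒳] {P Q : Measure (𝒳 × Fin 2)}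

lemma minClassProb_le (k : Fin 2) : minClassProb P ≤ classProb P k := by
  fin_cases k
  · exact min_le_left _ _
  · exact min_le_right _ _

lemma weightRatio_eq {m n : ℕ} (DP : Fin m → 𝒳 × Fin 2) (DQ : Fin n → 𝒳 × Fin 2) (k : Fin 2) :
    weightRatio P Q DP DQ k =
      (empClassProb DQ k / classProb Q k) / (empClassProb DP k / classProb P k) := by
  unfold weightRatio empWeight trueWeight
  rw [div_div_div_eq, div_div_div_eq]
  ring

variable [IsProbabilityMeasure P] [IsProbabilityMeasure Q]

/-- Relative accuracy of a class frequency with probability at least `1 - δ / 8`. -/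
lemma pi_empClassProb_le {δ : ℝ} (hδ : δ ∈ Ioo (0 : ℝ) 1) (hp : 0 < minClassProb P) {n : ℕ}
    (hn : 4 * Real.log (16 / δ) < minClassProb P * n) (k : Fin 2) :
    (Measure.pi fun _ : Fin n => P) {x | ¬ |empClassProb x k / classProb P k - 1| ≤
      Real.sqrt (4 * Real.log (16 / δ) / (minClassProb P * n))} ≤ ENNReal.ofReal (δ / 8) := by
  classical
  have hδ0 := hδ.1
  have hL : 0 < Real.log (16 / δ) := by
    refine Real.log_pos ?_
    rw [lt_div_iff₀ hδ0]; linarith [hδ.2]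
  set L := Real.log (16 / δ) with hLdef
  have hpn : 0 < minClassProb P * n := by linarith
  have hn0 : (0 : ℝ) < n := (pos_iff_pos_of_mul_pos hpn).1 hp
  have hpk : 0 < classProb P k := hp.trans_le (minClassProb_le k)
  set η := Real.sqrt (4 * L / (minClassProb P * n)) with hη
  have hη2 : η ^ 2 = 4 * L / (minClassProb P * n) := Real.sq_sqrt (by positivity)
  have hη1 : η ≤ 1 := by
    rw [hη, Real.sqrt_le_iff, one_pow, div_le_one hpn]
    exact ⟨zero_le_one, hn.le⟩
  have key := measureReal_pi_abs_card_sub_ge_le (κ := Fin n) P (measurableSet_label (𝒳 := 𝒳) k)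
    (η := η) (Real.sqrt_nonneg _) (by linarith)
  rw [Fintype.card_fin] at key
  rw [← ENNReal.ofReal_toReal (measure_ne_top _ _)]
  refine ENNReal.ofReal_le_ofReal ((measureReal_mono ?_).trans (key.trans ?_))
  · intro x hx
    simp only [mem_ofPred_eq, not_le] at hx ⊢
    have hpos : 0 < (n : ℝ) * classProb P k := mul_pos hn0 hpk
    have heq : empClassProb x k / classProb P k - 1 =
        (((Finset.univ.filter fun i => (x i).2 = k).card : ℝ) - n * classProb P k) /
          (n * classProb P k) := by
      unfold empClassProb
      field_simp
    rw [heq, abs_div, abs_of_pos hpos, lt_div_iff₀ hpos] at hx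
    exact hx.le
  · have h1 : Real.exp (-(η ^ 2 * (n * classProb P k) / 4)) ≤ δ / 16 := by
      rw [← Real.exp_log (show 0 < δ / 16 by positivity), Real.exp_le_exp,
        show δ / 16 = (16 / δ)⁻¹ by rw [inv_div], Real.log_inv, ← hLdef, hη2, neg_le_neg_iff]
      have h2 : 4 * L / (minClassProb P * n) * (n * classProb P k) / 4 =
          L * (classProb P k / minClassProb P) := by
        field_simp
      rw [h2]
      refine le_mul_of_one_le_right hL.le ?_
      rw [one_le_div hp]
      exact minClassProb_le k
    change 2 * Real.exp (-(η ^ 2 * (n * classProb P k) / 4)) ≤ δ / 8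
    linarith

lemma minClassProb_pos (h : classProb P 1 ∈ Ioo (0 : ℝ) 1) : 0 < minClassProb P :=
  lt_min (classProb_pos h 0) (classProb_pos h 1)

/-- The finite-sample bound, with the universal constant `32` in the lower bound on `nP`. -/
lemma finite_sample_risk_bound {f : 𝒳 → ℝ} (hf : Measurable f)
    (hf01 : ∀ x, f x ∈ Icc (0 : ℝ) 1) (hPQ : LabelShift P Q) {h : ℝ → ℝ} {K : ℝ} (hK : 0 ≤ K)
    (hreg : RegularScore P f h K) {δ : ℝ} (hδ : δ ∈ Ioo (0 : ℝ) 1) {nP nQ B : ℕ} (hB : 0 < B)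
    (hnP : max 32 (27 / minClassProb P) * (B * Real.log (4 * B / δ)) ≤ nP)
    (hnQ : 27 / minClassProb Q * Real.log (16 / δ) ≤ nQ)
    {Ω : Type*} [MeasurableSpace Ω] {μ : Measure Ω} [IsProbabilityMeasure μ]
    {DP : Fin nP → Ω → 𝒳 × Fin 2} {DQ : Fin nQ → Ω → 𝒳 × Fin 2}
    (hDP : IsIIDSample μ P DP) (hDQ : IsIIDSample μ Q DQ) :
    1 - δ ≤ μ.real {ω |
      risk Q f (compositeEstimator f (fun i => DP i ω) (fun i => DQ i ω) B) ≤
        2 * (maxWeight P Q ^ 3 / minWeight P Q ^ 2) *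
          ((Real.sqrt (1 / (2 * (((nP / B : ℕ) : ℝ) - 1)) * Real.log (8 * B / δ)) +
              1 / ((nP / B : ℕ) : ℝ)) ^ 2 + 8 * K ^ 2 / (B : ℝ) ^ 2) +
        54 * max (1 / (minClassProb P * nP)) (1 / (minClassProb Q * nQ)) *
          Real.log (16 / δ)} := by
  have hp := minClassProb_pos hPQ.source_mem
  have hq := minClassProb_pos hPQ.target_mem
  have hδ0 := hδ.1
  have hB' : (1 : ℝ) ≤ B := by exact_mod_cast hB
  have hlog4 : 0 < Real.log (4 / δ) := by
    refine Real.log_pos ?_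
    rw [lt_div_iff₀ hδ0]; linarith [hδ.2]
  -- the sample size condition is stated with `log (4 B / δ)`, and `16 / δ ≤ (4 / δ) ^ 2`
  have hL4 : Real.log (16 / δ) ≤ 2 * Real.log (4 / δ) := by
    have h2 : (2 : ℝ) * Real.log (4 / δ) = Real.log ((4 / δ) ^ 2) := by
      rw [Real.log_pow]; norm_num
    rw [h2]
    refine Real.log_le_log (by positivity) ?_
    rw [div_pow, div_le_div_iff₀ hδ0 (by positivity)]
    nlinarith [hδ.2]
  have hL : 0 < Real.log (16 / δ) := by
    refine Real.log_pos ?_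
    rw [lt_div_iff₀ hδ0]; linarith [hδ.2]
  have hlogB : Real.log (4 / δ) ≤ Real.log (4 * B / δ) :=
    Real.log_le_log (by positivity) (by gcongr; linarith)
  have hBlog : Real.log (4 / δ) ≤ B * Real.log (4 * B / δ) := by nlinarith
  set L := Real.log (16 / δ) with hLdef
  have hnP32 : 32 * (B * Real.log (4 * B / δ)) ≤ nP :=
    le_trans (mul_le_mul_of_nonneg_right (le_max_left _ _) (by linarith)) hnP
  have hnP27 : 27 * Real.log (4 / δ) ≤ minClassProb P * nP := by
    have h1 : 27 / minClassProb P * Real.log (4 / δ) ≤ nP :=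
      le_trans (mul_le_mul (le_max_right _ _) hBlog hlog4.le (by positivity)) hnP
    rw [div_mul_eq_mul_div, div_le_iff₀ hp] at h1
    linarith
  have hnQ27 : 27 * L ≤ minClassProb Q * nQ := by
    rw [div_mul_eq_mul_div, div_le_iff₀ hq] at hnQ
    linarith
  have hP4 : 4 * L < minClassProb P * nP := by linarith
  have hQ4 : 4 * L < minClassProb Q * nQ := by linarith
  have hQn : (0 : ℝ) < nQ := (pos_iff_pos_of_mul_pos (by linarith : 0 < minClassProb Q * nQ)).1 hq
  have hsqrt : ∀ {s : ℝ}, 4 * L < s → Real.sqrt (4 * L / s) ∈ Ico (0 : ℝ) 1 := fun {s} hs =>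
    ⟨Real.sqrt_nonneg _, by
      rw [Real.sqrt_lt' one_pos, one_pow, div_lt_one (by linarith)]; exact hs⟩
  set a := Real.sqrt (4 * L / (minClassProb P * nP)) with ha
  set b := Real.sqrt (4 * L / (minClassProb Q * nQ)) with hb
  set R := (Real.sqrt (1 / (2 * (((nP / B : ℕ) : ℝ) - 1)) * Real.log (8 * B / δ)) +
      1 / ((nP / B : ℕ) : ℝ)) ^ 2 + 8 * K ^ 2 / (B : ℝ) ^ 2 with hR
  set S := max (1 / (minClassProb P * nP)) (1 / (minClassProb Q * nQ)) with hS
  set good := {ω | risk Q f (compositeEstimator f (fun i => DP i ω) (fun i => DQ i ω) B) ≤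
        2 * (maxWeight P Q ^ 3 / minWeight P Q ^ 2) * R + 54 * S * L} with hgood
  let XR : Set Ω := {ω | (fun i => DP i ω) ∈ {x | ¬ risk P f (umbRecalibration f x B) ≤ R}}
  let XP : Fin 2 → Set Ω := fun k =>
    {ω | (fun i => DP i ω) ∈ {x | ¬ |empClassProb x k / classProb P k - 1| ≤ a}}
  let XQ : Fin 2 → Set Ω := fun k =>
    {ω | (fun i => DQ i ω) ∈ {x | ¬ |empClassProb x k / classProb Q k - 1| ≤ b}}
  have hXR : μ XR ≤ ENNReal.ofReal (δ / 2) :=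
    (hDP.measure_le_pi _).trans (pi_risk_umbRecalibration_gt_le hf hf01 hreg hK hδ hB hnP32)
  have hXP : ∀ k, μ (XP k) ≤ ENNReal.ofReal (δ / 8) := fun k =>
    (hDP.measure_le_pi _).trans (pi_empClassProb_le hδ hp hP4 k)
  have hXQ : ∀ k, μ (XQ k) ≤ ENNReal.ofReal (δ / 8) := fun k =>
    (hDQ.measure_le_pi _).trans (pi_empClassProb_le hδ hq hQ4 k)
  have hsub : goodᶜ ⊆ XR ∪ ((XP 0 ∪ XP 1) ∪ (XQ 0 ∪ XQ 1)) := by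
    intro ω hω
    by_contra hcon
    simp only [mem_union, not_or, XR, XP, XQ, mem_ofPred_eq, not_not] at hcon
    obtain ⟨h1, ⟨h2, h3⟩, h4, h5⟩ := hcon
    have hα : ∀ k, |empClassProb (fun i => DP i ω) k / classProb P k - 1| ≤ a :=
      Fin.forall_fin_two.2 ⟨h2, h3⟩
    have hβ : ∀ k, |empClassProb (fun i => DQ i ω) k / classProb Q k - 1| ≤ b :=
      Fin.forall_fin_two.2 ⟨h4, h5⟩
    have haI : a ∈ Ico (0 : ℝ) 1 := hsqrt hP4
    have hbI : b ∈ Ico (0 : ℝ) 1 := hsqrt hQ4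
    refine hω ?_
    have hDPpos : ∀ k, 0 < empClassProb (fun i => DP i ω) k := fun k => by
      have h := (abs_le.1 (hα k)).1
      have hpos : 0 < empClassProb (fun i => DP i ω) k / classProb P k := by linarith [haI.2]
      exact (div_pos_iff_of_pos_right (classProb_pos hPQ.source_mem k)).1 hpos
    have hdet := risk_compositeEstimator_le hf hf01 hPQ (B := B)
      (by exact_mod_cast hQn) (fun i => DP i ω) (fun i => DQ i ω) hDPpos
    have hratio := abs_ratio_le haI hbI hα hβ
    simp only [← weightRatio_eq] at hratio
    have hsq := pow_le_pow_left₀ (abs_nonneg _) hratio 2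
    rw [sq_abs] at hsq
    have ha2 : a ^ 2 ≤ 4 * L * S := by
      rw [ha, Real.sq_sqrt (by positivity), div_eq_mul_one_div]
      exact mul_le_mul_of_nonneg_left (le_max_left _ _) (by linarith)
    have hb2 : b ^ 2 ≤ 4 * L * S := by
      rw [hb, Real.sq_sqrt (by positivity), div_eq_mul_one_div]
      exact mul_le_mul_of_nonneg_left (le_max_right _ _) (by linarith)
    have hab := add_sq_le (a := a) (b := b)
    have hSL : 0 ≤ L * S := mul_nonneg hL.le (le_max_of_le_left (by positivity))
    have hW : 0 ≤ maxWeight P Q ^ 3 / minWeight P Q ^ 2 :=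
      div_nonneg (pow_nonneg (le_max_of_le_left (trueWeight_pos hPQ 0).le) 3) (sq_nonneg _)
    have hWR := mul_le_mul_of_nonneg_left h1 hW
    rw [hgood, mem_ofPred_eq]
    linarith
  have hle : μ goodᶜ ≤ ENNReal.ofReal δ := by
    refine (measure_mono hsub).trans ((measure_union_le _ _).trans ?_)
    refine (add_le_add hXR ((measure_union_le _ _).trans (add_le_add
      ((measure_union_le _ _).trans (add_le_add (hXP 0) (hXP 1)))
      ((measure_union_le _ _).trans (add_le_add (hXQ 0) (hXQ 1)))))).trans (le_of_eq ?_)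
    rw [← ENNReal.ofReal_add, ← ENNReal.ofReal_add, ← ENNReal.ofReal_add]
    · congr 1; ring
    all_goals positivity
  have hreal : μ.real goodᶜ ≤ δ := ENNReal.toReal_le_of_le_ofReal hδ0.le hle
  have hone : (1 : ℝ) ≤ μ.real good + μ.real goodᶜ := by
    rw [← probReal_univ (μ := μ), ← union_compl_self good]
    exact measureReal_union_le _ _
  linarith

end Weights

section SampleComplexity

/-- With a number of bins of order `n ^ (1/3)`, the number of source data is eventually sufficient
for the finite-sample bound, and the terms of the bound that do not involve the target sample tend
to `0`. -/
lemma exists_source_sample_size {W K L p δ ε a₁ a₂ : ℝ} (hW : 0 ≤ W) (hp : 0 < p) (hL : 0 ≤ L)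
    (hδ : δ ∈ Ioo (0 : ℝ) 1) (hε : 0 < ε) (ha₁ : 0 < a₁) (ha : a₁ ≤ a₂) :
    ∃ N : ℕ, ∀ n B : ℕ, N ≤ n → a₁ * (n : ℝ) ^ (1 / 3 : ℝ) ≤ B → B ≤ a₂ * (n : ℝ) ^ (1 / 3 : ℝ) →
      0 < B ∧ max 32 (27 / p) * (B * Real.log (4 * B / δ)) ≤ n ∧
      2 * W * ((Real.sqrt (1 / (2 * (((n / B : ℕ) : ℝ) - 1)) * Real.log (8 * B / δ)) +
              1 / ((n / B : ℕ) : ℝ)) ^ 2 + 8 * K ^ 2 / (B : ℝ) ^ 2) ≤ ε / 2 ∧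
      54 * (1 / (p * n)) * L ≤ ε / 2 := by
  have hδ0 := hδ.1
  have ha₂ : 0 < a₂ := ha₁.trans_le ha
  set A := 2 * W * (16 * a₂ ^ 2 / δ + 8 * a₂ ^ 2 + 8 * K ^ 2 / a₁ ^ 2) with hA
  have hA0 : 0 ≤ A := by positivity
  set X := max (max 1 (4 * a₂)) (max (4 * max 32 (27 / p) * a₂ ^ 2 / δ)
    (max (2 * A / ε) (108 * L / (p * ε)))) with hX
  have htend : Filter.Tendsto (fun n : ℕ => (n : ℝ) ^ (1 / 3 : ℝ)) Filter.atTop Filter.atTop :=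
    (tendsto_rpow_atTop (by norm_num)).comp tendsto_natCast_atTop_atTop
  obtain ⟨N, hN⟩ := Filter.eventually_atTop.1 (htend.eventually_ge_atTop X)
  refine ⟨N, fun n B hn h1 h2 => ?_⟩
  have hx := hN n hn
  set x := (n : ℝ) ^ (1 / 3 : ℝ) with hxdef
  have hx3 : x ^ 3 = n := by
    rw [hxdef, ← Real.rpow_natCast, ← Real.rpow_mul (Nat.cast_nonneg n)]
    norm_num
  have hx1 : 1 ≤ x := (le_max_left _ _).trans ((le_max_left _ _).trans hx)
  have hxa : 4 * a₂ ≤ x := (le_max_right _ _).trans ((le_max_left _ _).trans hx)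
  have hxc : 4 * max 32 (27 / p) * a₂ ^ 2 / δ ≤ x :=
    (le_max_left _ _).trans ((le_max_right _ _).trans hx)
  have hxA : 2 * A / ε ≤ x :=
    (le_max_left _ _).trans ((le_max_right _ _).trans ((le_max_right _ _).trans hx))
  have hxL : 108 * L / (p * ε) ≤ x :=
    (le_max_right _ _).trans ((le_max_right _ _).trans ((le_max_right _ _).trans hx))
  have hx0 : 0 < x := by linarith
  have hB0 : (0 : ℝ) < B := (mul_pos ha₁ hx0).trans_le h1
  have hBpos : 0 < B := by exact_mod_cast hB0
  have hx2 : x ≤ x ^ 2 := by nlinarith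
  have hx4 : x ≤ x ^ 4 := by
    calc x = x ^ 1 := (pow_one x).symm
      _ ≤ x ^ 4 := pow_le_pow_right₀ hx1 (by norm_num)
  have hxn : x ≤ n := by
    rw [← hx3]
    calc x = x ^ 1 := (pow_one x).symm
      _ ≤ x ^ 3 := pow_le_pow_right₀ hx1 (by norm_num)
  have hlog : ∀ y : ℝ, 0 < y → Real.log y ≤ y := fun y hy => Real.log_le_self hy.le
  refine ⟨hBpos, ?_, ?_, ?_⟩
  · have hc0 : 0 ≤ max 32 (27 / p) := le_max_of_le_left (by norm_num)
    calc max 32 (27 / p) * (B * Real.log (4 * B / δ))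
        ≤ max 32 (27 / p) * (B * (4 * B / δ)) := by
          gcongr
          exact hlog _ (by positivity)
      _ ≤ max 32 (27 / p) * ((a₂ * x) * (4 * (a₂ * x) / δ)) := by gcongr
      _ = (4 * max 32 (27 / p) * a₂ ^ 2 / δ) * x ^ 2 := by ring
      _ ≤ x * x ^ 2 := by gcongr
      _ = n := by rw [← hx3]; ring
  · -- the bins contain at least `x ^ 2 / (2 a₂) + 1` scores, where `x = n ^ (1/3)`
    have hm : x ^ 2 / (2 * a₂) + 1 ≤ ((n / B : ℕ) : ℝ) := by
      have hf1 : (n : ℝ) / B < ((n / B : ℕ) : ℝ) + 1 := by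
        rw [div_lt_iff₀ hB0]
        have h : n < (n / B + 1) * B := by
          rw [add_mul, one_mul]; exact Nat.lt_div_mul_add hBpos
        exact_mod_cast h
      have hf2 : x ^ 2 / a₂ ≤ (n : ℝ) / B := by
        rw [div_le_div_iff₀ ha₂ hB0, ← hx3]
        calc x ^ 2 * B ≤ x ^ 2 * (a₂ * x) := by gcongr
          _ = x ^ 3 * a₂ := by ring
      have hf3 : 2 ≤ x ^ 2 / (2 * a₂) := by
        rw [le_div_iff₀ (by positivity)]; linarith
      have hf4 : x ^ 2 / a₂ = 2 * (x ^ 2 / (2 * a₂)) := by field_simp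
      linarith
    set m := ((n / B : ℕ) : ℝ)
    have hy0 : 0 < x ^ 2 / (2 * a₂) := by positivity
    have hT1 : Real.sqrt (1 / (2 * (m - 1)) * Real.log (8 * B / δ)) ^ 2 ≤
        8 * a₂ ^ 2 / δ / x := by
      have hlog0 : 0 ≤ Real.log (8 * B / δ) := by
        refine Real.log_nonneg ?_
        have : (1 : ℝ) ≤ B := by exact_mod_cast hBpos
        rw [le_div_iff₀ hδ0]; linarith [hδ.2]
      have hm1 : 0 < m - 1 := by linarith
      rw [Real.sq_sqrt (by positivity)]
      calc 1 / (2 * (m - 1)) * Real.log (8 * B / δ)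
          ≤ 1 / (2 * (x ^ 2 / (2 * a₂))) * (8 * (a₂ * x) / δ) := by
            have : x ^ 2 / (2 * a₂) ≤ m - 1 := by linarith
            gcongr
            exact (hlog _ (by positivity)).trans (by gcongr)
        _ = 8 * a₂ ^ 2 / δ / x := by field_simp
    have hT2 : (1 / m) ^ 2 ≤ 4 * a₂ ^ 2 / x := by
      calc (1 / m) ^ 2 ≤ (1 / (x ^ 2 / (2 * a₂))) ^ 2 := by
            have : x ^ 2 / (2 * a₂) ≤ m := by linarith
            gcongr
        _ = 4 * a₂ ^ 2 / x ^ 4 := by field_simp; norm_num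
        _ ≤ 4 * a₂ ^ 2 / x := by gcongr
    have hT3 : 8 * K ^ 2 / (B : ℝ) ^ 2 ≤ 8 * K ^ 2 / a₁ ^ 2 / x := by
      calc 8 * K ^ 2 / (B : ℝ) ^ 2 ≤ 8 * K ^ 2 / (a₁ * x) ^ 2 := by gcongr
        _ = 8 * K ^ 2 / a₁ ^ 2 / x ^ 2 := by field_simp
        _ ≤ 8 * K ^ 2 / a₁ ^ 2 / x := by gcongr
    have hsq := add_sq_le (a := Real.sqrt (1 / (2 * (m - 1)) * Real.log (8 * B / δ)))
      (b := 1 / m)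
    have hfin : A / x ≤ ε / 2 := by
      rw [div_le_iff₀ hε] at hxA
      rw [div_le_iff₀ hx0]
      linarith
    refine le_trans ?_ hfin
    have hAx : A / x = 2 * W * (2 * (8 * a₂ ^ 2 / δ / x + 4 * a₂ ^ 2 / x) +
        8 * K ^ 2 / a₁ ^ 2 / x) := by
      rw [hA]; ring
    rw [hAx]
    refine mul_le_mul_of_nonneg_left ?_ (by positivity)
    linarith
  · calc 54 * (1 / (p * n)) * L ≤ 54 * (1 / (p * x)) * L := by gcongr
      _ ≤ ε / 2 := by
        rw [div_le_iff₀ (by positivity)] at hxL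
        have : 54 * (1 / (p * x)) * L = 54 * L / (p * x) := by ring
        rw [this, div_le_iff₀ (by positivity)]
        linarith

end SampleComplexity

end LabelShiftRecalibration

/-! ### The bounds for the composite estimator -/

open LabelShiftRecalibration in
theorem mainTheorem2 :
    -- the deterministic bound, for all data sets for which the estimated weights are defined
    (∀ (𝒳 : Type*) [MeasurableSpace 𝒳] (P Q : Measure (𝒳 × Fin 2))
      [IsProbabilityMeasure P] [IsProbabilityMeasure Q] (f : 𝒳 → ℝ),
      Measurable f → (∀ x, f x ∈ Icc (0 : ℝ) 1) → LabelShift P Q →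
      ∀ (nP nQ B : ℕ), 0 < nQ → 0 < B →
      ∀ (DP : Fin nP → 𝒳 × Fin 2) (DQ : Fin nQ → 𝒳 × Fin 2),
      (∀ k, 0 < empClassProb DP k) →
      risk Q f (compositeEstimator f DP DQ B) ≤
        2 * (((weightRatio P Q DP DQ 0 - weightRatio P Q DP DQ 1) /
                (weightRatio P Q DP DQ 0 + weightRatio P Q DP DQ 1)) ^ 2 +
          maxWeight P Q ^ 3 / minWeight P Q ^ 2 * risk P f (umbRecalibration f DP B)))
    ∧
    -- the finite-sample bound with a universal constant
    (∃ c : ℝ, 0 < c ∧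
      ∀ (𝒳 : Type*) [MeasurableSpace 𝒳] (P Q : Measure (𝒳 × Fin 2))
      [IsProbabilityMeasure P] [IsProbabilityMeasure Q] (f : 𝒳 → ℝ),
      Measurable f → (∀ x, f x ∈ Icc (0 : ℝ) 1) → LabelShift P Q →
      ∀ (h : ℝ → ℝ) (K : ℝ), 0 ≤ K → RegularScore P f h K →
      ∀ (δ : ℝ), δ ∈ Ioo (0 : ℝ) 1 → ∀ (nP nQ B : ℕ), 0 < B →
      max c (27 / minClassProb P) * (B * Real.log (4 * B / δ)) ≤ nP →
      27 / minClassProb Q * Real.log (16 / δ) ≤ nQ →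
      ∀ (Ω : Type*) [MeasurableSpace Ω] (μ : Measure Ω) [IsProbabilityMeasure μ]
        (DP : Fin nP → Ω → 𝒳 × Fin 2) (DQ : Fin nQ → Ω → 𝒳 × Fin 2),
      IsIIDSample μ P DP → IsIIDSample μ Q DQ →
      1 - δ ≤ μ.real {ω |
        risk Q f (compositeEstimator f (fun i => DP i ω) (fun i => DQ i ω) B) ≤
          2 * (maxWeight P Q ^ 3 / minWeight P Q ^ 2) *
            ((Real.sqrt (1 / (2 * (((nP / B : ℕ) : ℝ) - 1)) * Real.log (8 * B / δ)) +
                1 / ((nP / B : ℕ) : ℝ)) ^ 2 + 8 * K ^ 2 / (B : ℝ) ^ 2) +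
          54 * max (1 / (minClassProb P * nP)) (1 / (minClassProb Q * nQ)) *
            Real.log (16 / δ)})
    ∧
    -- the target sample complexity: `O(1 / ε)` target labels suffice for risk at most `ε`,
    -- given enough source data and a number of bins of order `nP ^ (1/3)`
    (∃ C : ℝ, 0 < C ∧
      ∀ (𝒳 : Type*) [MeasurableSpace 𝒳] (P Q : Measure (𝒳 × Fin 2))
      [IsProbabilityMeasure P] [IsProbabilityMeasure Q] (f : 𝒳 → ℝ),
      Measurable f → (∀ x, f x ∈ Icc (0 : ℝ) 1) → LabelShift P Q →
      ∀ (h : ℝ → ℝ) (K : ℝ), 0 ≤ K → RegularScore P f h K →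
      ∀ (δ : ℝ), δ ∈ Ioo (0 : ℝ) 1 → ∀ (ε : ℝ), ε ∈ Ioo (0 : ℝ) 1 →
      ∀ (a₁ a₂ : ℝ), 0 < a₁ → a₁ ≤ a₂ →
      ∃ N : ℕ, ∀ (nP nQ B : ℕ), N ≤ nP →
      a₁ * (nP : ℝ) ^ (1 / 3 : ℝ) ≤ B → B ≤ a₂ * (nP : ℝ) ^ (1 / 3 : ℝ) →
      C * Real.log (16 / δ) / minClassProb Q * (1 / ε) ≤ nQ →
      ∀ (Ω : Type*) [MeasurableSpace Ω] (μ : Measure Ω) [IsProbabilityMeasure μ]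
        (DP : Fin nP → Ω → 𝒳 × Fin 2) (DQ : Fin nQ → Ω → 𝒳 × Fin 2),
      IsIIDSample μ P DP → IsIIDSample μ Q DQ →
      1 - δ ≤ μ.real {ω |
        risk Q f (compositeEstimator f (fun i => DP i ω) (fun i => DQ i ω) B) ≤ ε}) := by
  -- with `C = 108` the target term `54 log (16 / δ) / (q_min nQ)` is at most half the risk level
  refine ⟨?_, ⟨32, by norm_num, ?_⟩, ⟨108, by norm_num, ?_⟩⟩
  · intro 𝒳 _ P Q _ _ f hf hf01 hPQ nP nQ B hnQ _ DP DQ hDP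
    exact risk_compositeEstimator_le hf hf01 hPQ hnQ DP DQ hDP
  · intro 𝒳 _ P Q _ _ f hf hf01 hPQ h K hK hreg δ hδ nP nQ B hB hnP hnQ Ω _ μ _ DP DQ hDP hDQ
    exact finite_sample_risk_bound hf hf01 hPQ hK hreg hδ hB hnP hnQ hDP hDQ
  · intro 𝒳 _ P Q _ _ f hf hf01 hPQ h K hK hreg δ hδ ε hε a₁ a₂ ha₁ ha
    have hp := minClassProb_pos hPQ.source_mem
    have hq := minClassProb_pos hPQ.target_mem
    have hL : 0 < Real.log (16 / δ) := by
      refine Real.log_pos ?_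
      rw [lt_div_iff₀ hδ.1]; linarith [hδ.2]
    have hW : 0 ≤ maxWeight P Q ^ 3 / minWeight P Q ^ 2 :=
      div_nonneg (pow_nonneg (le_max_of_le_left (trueWeight_pos hPQ 0).le) 3) (sq_nonneg _)
    obtain ⟨N, hN⟩ := exists_source_sample_size (K := K) hW hp hL.le hδ hε.1 ha₁ ha
    refine ⟨N, fun nP nQ B hnP hB1 hB2 hnQ Ω _ μ _ DP DQ hDP hDQ => ?_⟩
    obtain ⟨hB, hsize, hrisk, hsource⟩ := hN nP B hnP hB1 hB2
    -- the target sample is large enough for its term in the bound to be at most `ε / 2`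
    have hnQ' : 108 * Real.log (16 / δ) ≤ ε * (minClassProb Q * nQ) := by
      rw [div_mul_div_comm, mul_one, div_le_iff₀ (mul_pos hq hε.1)] at hnQ
      linarith
    have hqn : 0 < minClassProb Q * nQ :=
      (pos_iff_pos_of_mul_pos (by linarith : 0 < ε * (minClassProb Q * nQ))).1 hε.1
    have htarget : 54 * (1 / (minClassProb Q * nQ)) * Real.log (16 / δ) ≤ ε / 2 := by
      rw [mul_one_div, div_mul_eq_mul_div, div_le_iff₀ hqn]
      linarith
    have hsizeQ : 27 / minClassProb Q * Real.log (16 / δ) ≤ nQ := by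
      rw [div_mul_eq_mul_div, div_le_iff₀ hq]
      have : ε * (minClassProb Q * nQ) ≤ 1 * (minClassProb Q * nQ) :=
        mul_le_mul_of_nonneg_right hε.2.le hqn.le
      linarith
    refine (finite_sample_risk_bound hf hf01 hPQ hK hreg hδ hB hsize hsizeQ hDP hDQ).trans
      (measureReal_mono fun ω hω => ?_)
    rw [mem_ofPred_eq] at hω ⊢
    refine hω.trans ?_
    have hmax : 54 * max (1 / (minClassProb P * nP)) (1 / (minClassProb Q * nQ)) *
        Real.log (16 / δ) ≤ ε / 2 := by
      rcases max_choice (1 / (minClassProb P * nP)) (1 / (minClassProb Q * nQ)) with h | h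
      · rw [h]; exact hsource
      · rw [h]; exact htarget
    linarith
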